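/- Let $G=(V,E)$ be an infinite, connected, simple graph of bounded degree which is quasi-transitive, i.e. $V$ can be partitioned into finitely many classes such that for any two vertices $u,w$ of the same class some graph automorphism of $G$ maps $u$ to $w$. Let $(\eta_0(u))_{u\in V}$ be i.i.d. random variables, uniformly distributed on $[0,1]$ (the initial water levels), and fix a vertex $v\in V$. A move $(\langle x,y\rangle,\mu)\in E\times(0,\tfrac12]$ changes a profile $\eta\in\mathbb{R}^V$ by replacing $\eta(x)$ with $\eta(x)+\mu(\eta(y)-\eta(x))$ and $\eta(y)$ with $\eta(y)+\mu(\eta(x)-\eta(y))$, leaving all other values unchanged. Let $$\kappa_G(v)=\sup\{r\ge 0:\ \text{there are } T\in\mathbb{N}_0 \text{ and a sequence of } T \text{ moves, leading from } \eta_0 \text{ to a profile } \eta_T, \text{ such that } \eta_T(v)=r\}.$$ For a real random variable $X$ put $\mathrm{supp}(X)=\{r\in\mathbb{R}:\ \mathbb{P}(|X-r|<\varepsilon)>0 \text{ for all } \varepsilon>0\}$. Then $\kappa_G(v)$ is a random variable (i.e. measurable), and the following hold. 1. If $G$ is (isomorphic to) the two-sided infinite path, with vertex set $\mathbb{Z}$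 and edges $\langle u,u+1\rangle$, $u\in\mathbb{Z}$, then $$\mathbb{P}\big(\tfrac12<\kappa_G(v)<1\big)=1\quad\text{and}\quad \{\tfrac12,1\}\subseteq\mathrm{supp}(\kappa_G(v)).$$ 2. If $G$ is not (isomorphic to) the two-sided infinite path, then $\kappa_G(v)=1$ almost surely. -/

import Mathlib

open MeasureTheory ProbabilityTheory

/-- A single move `(e, μ)` in `E × (0, 1/2]`: the edge `e = ⟨x, y⟩` of `G` that is opened and the
transferred fraction `μ`. -/
structure WaterMove {V : Type*} (G : SimpleGraph V) where
  x : V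
  y : V
  adj : G.Adj x y
  μ : ℝ
  μ_pos : 0 < μ
  μ_le : μ ≤ 1 / 2

open Classical in
/-- The water profile after one move: with `a = η x` and `b = η y`, the new levels at `x` and `y`
are `a + μ (b - a)` and `b + μ (a - b)`; all other levels stay unchanged. -/
noncomputable def WaterMove.apply {V : Type*} {G : SimpleGraph V} (η : V → ℝ)
    (m : WaterMove G) : V → ℝ :=
  fun w =>
    if w = m.x then η m.x + m.μ * (η m.y - η m.x)
    else if w = m.y then η m.y + m.μ * (η m.x - η m.y)
    else η w

/-- The final profile `η_T` after a finite sequence of `T` moves (`T = 0` allowed), performed in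
chronological order (the head of the list first), starting from the profile `η`. -/
noncomputable def waterProfile {V : Type*} {G : SimpleGraph V} (η : V → ℝ)
    (moves : List (WaterMove G)) : V → ℝ :=
  moves.foldl WaterMove.apply η

/-- `κ_G(v)`: the supremum of all water levels `r ≥ 0` achievable at `v` by finite move sequences,
starting from the profile `η`. For profiles with values in `[0, 1]` the set is nonempty and bounded
by `1`, so this is a genuine supremum. -/
noncomputable def waterKappa {V : Type*} (G : SimpleGraph V) (η : V → ℝ) (v : V) : ℝ :=
  sSup {r : ℝ | 0 ≤ r ∧ ∃ moves : List (WaterMove G), waterProfile η moves v = r}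

/-- Quasi-transitivity: the vertex set can be partitioned into finitely many classes (the fibres
of `c`) such that for any two vertices in the same class some graph automorphism maps the first to
the second. -/
def SimpleGraph.IsQuasiTransitive {V : Type*} (G : SimpleGraph V) : Prop :=
  ∃ (n : ℕ) (c : V → Fin n), ∀ u w : V, c u = c w → ∃ f : G ≃g G, f u = w

/-- The two-sided infinite path `ℤ`, with edges `⟨u, u + 1⟩` for `u : ℤ`. -/
def twoSidedPath : SimpleGraph ℤ where
  Adj u w := w = u + 1 ∨ u = w + 1
  symm := ⟨fun _ _ h => h.symm⟩
  loopless := ⟨fun u h => by omega⟩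

/-- The graph `G` is (isomorphic to) the two-sided infinite path. -/
def SimpleGraph.IsTwoSidedPath {V : Type*} (G : SimpleGraph V) : Prop :=
  Nonempty (G ≃g twoSidedPath)

/-- The support of the distribution of a real random variable `X`: all `r` such that
`P (|X - r| < ε) > 0` for every `ε > 0`. -/
def distSupport {Ω : Type*} [MeasurableSpace Ω] (P : Measure Ω) (X : Ω → ℝ) : Set ℝ :=
  {r : ℝ | ∀ ε : ℝ, 0 < ε → 0 < P {ω | |X ω - r| < ε}}

/-! The argument works in the pointwise closure of the reachable profiles. There the levels on a
finite connected set can be equalised exactly (`exists_average`), and κ still bounds the level of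
every limit profile (`le_waterKappa`).

Off the two-sided path, some vertex has degree other than two
(`isTwoSidedPath_of_encard_neighborSet`), and quasi-transitivity puts such vertices within bounded
distance of every vertex. Long geodesics from `v` then carry distinct side branches at positions i_k
= O(k). A branch with level at least ℓ shrinks the gap between ℓ and the lower bound along the path
by the factor 1 - 1/(2(i_k + 1)) (`exists_raise`). Branches qualify independently with probability 1
- ℓ, so divergence of the harmonic series drives the expected remaining gap to 0; finally ℓ → 1.

On the path, κ > 1/2 because the centred partial sums of the levels along a ray become positive at
some time, and averaging up to that time suffices. Upper bounds come from a function Φ(i, j) that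
dominates the water content of every interval [i, j) and is concave in each endpoint: moves preserve
the domination (`sum_Ico_exchange_le`), so κ ≤ Φ(0, 1). Take Φ to be a multiple of the length plus a
multiple of `sqrtWeight`. Sub-Gaussian tails make the probabilities of overfull intervals summable.
For κ < 1 the finitely many overfull intervals are absorbed by moving Φ close to the length; for 1/2
in the support they are avoided by prescribing low levels on a finite set. The value 1 is in the
support since the initial level at `v` can be close to 1. -/

section Water

variable {V : Type*} {G : SimpleGraph V}

/-! ### Single moves: convexity, conservation of mass, energy. -/

namespace WaterMove

theorem apply_x (η : V → ℝ) (m : WaterMove G) :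
    m.apply η m.x = η m.x + m.μ * (η m.y - η m.x) := by
  simp [WaterMove.apply]

theorem apply_y (η : V → ℝ) (m : WaterMove G) :
    m.apply η m.y = η m.y + m.μ * (η m.x - η m.y) := by
  simp [WaterMove.apply, m.adj.ne']

theorem apply_of_ne (η : V → ℝ) (m : WaterMove G) {w : V} (hx : w ≠ m.x) (hy : w ≠ m.y) :
    m.apply η w = η w := by
  simp [WaterMove.apply, hx, hy]

theorem continuous_apply (m : WaterMove G) :
    Continuous (fun η : V → ℝ => m.apply η) := by
  refine continuous_pi fun w => ?_
  unfold WaterMove.apply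
  split_ifs <;> fun_prop

/-- Levels in a convex set stay in that set under a move. -/
theorem apply_mem_of_convex {s : Set ℝ} (hs : Convex ℝ s) (η : V → ℝ) (m : WaterMove G)
    (hx : η m.x ∈ s) (hy : η m.y ∈ s) {w : V} (hw : η w ∈ s) : m.apply η w ∈ s := by
  have h := m.μ_pos
  have h' := m.μ_le
  by_cases h1 : w = m.x
  · subst h1
    rw [apply_x]
    have := hs hx hy (a := 1 - m.μ) (b := m.μ) (by linarith) h.le (by ring)
    simp only [smul_eq_mul] at this
    convert this using 1
    ring
  · by_cases h2 : w = m.y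
    · subst h2
      rw [apply_y]
      have := hs hy hx (a := 1 - m.μ) (b := m.μ) (by linarith) h.le (by ring)
      simp only [smul_eq_mul] at this
      convert this using 1
      ring
    · rwa [apply_of_ne _ _ h1 h2]

theorem sum_apply [DecidableEq V] (η : V → ℝ) (m : WaterMove G) (S : Finset V)
    (hx : m.x ∈ S) (hy : m.y ∈ S) : ∑ w ∈ S, m.apply η w = ∑ w ∈ S, η w := by
  have hy' : m.y ∈ S.erase m.x := Finset.mem_erase.2 ⟨m.adj.ne', hy⟩
  have key : ∀ f : V → ℝ, ∑ w ∈ S, f w = f m.x + (f m.y + ∑ w ∈ (S.erase m.x).erase m.y, f w) :=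
    fun f => by rw [Finset.add_sum_erase _ _ hy', Finset.add_sum_erase _ _ hx]
  rw [key, key η, apply_x, apply_y]
  have : ∑ w ∈ (S.erase m.x).erase m.y, m.apply η w = ∑ w ∈ (S.erase m.x).erase m.y, η w := by
    refine Finset.sum_congr rfl fun w hw => ?_
    rw [Finset.mem_erase, Finset.mem_erase] at hw
    exact apply_of_ne _ _ hw.2.1 hw.1
  rw [this]
  ring

/-- The energy drops strictly unless the two levels agree, so a profile of minimal energy is
constant along edges. -/
theorem sum_sq_apply [DecidableEq V] (η : V → ℝ) (m : WaterMove G) (S : Finset V)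
    (hx : m.x ∈ S) (hy : m.y ∈ S) :
    ∑ w ∈ S, m.apply η w ^ 2
      = ∑ w ∈ S, η w ^ 2 - 2 * m.μ * (1 - m.μ) * (η m.x - η m.y) ^ 2 := by
  have hy' : m.y ∈ S.erase m.x := Finset.mem_erase.2 ⟨m.adj.ne', hy⟩
  have key : ∀ f : V → ℝ, ∑ w ∈ S, f w = f m.x + (f m.y + ∑ w ∈ (S.erase m.x).erase m.y, f w) :=
    fun f => by rw [Finset.add_sum_erase _ _ hy', Finset.add_sum_erase _ _ hx]
  rw [key, key (fun w => η w ^ 2), apply_x, apply_y]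
  have : ∑ w ∈ (S.erase m.x).erase m.y, m.apply η w ^ 2
      = ∑ w ∈ (S.erase m.x).erase m.y, η w ^ 2 := by
    refine Finset.sum_congr rfl fun w hw => ?_
    rw [Finset.mem_erase, Finset.mem_erase] at hw
    rw [apply_of_ne _ _ hw.2.1 hw.1]
  rw [this]
  ring

end WaterMove

/-! ### Approximable profiles and measurability of κ. -/

/-- The profiles that can be approximated pointwise by profiles reachable from `η`. -/
def waterClosure (G : SimpleGraph V) (η : V → ℝ) : Set (V → ℝ) :=
  closure (Set.range fun moves : List (WaterMove G) => waterProfile η moves)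

theorem self_mem_waterClosure (η : V → ℝ) : η ∈ waterClosure G η :=
  subset_closure ⟨[], rfl⟩

theorem apply_mem_waterClosure {η ζ : V → ℝ} (hζ : ζ ∈ waterClosure G η) (m : WaterMove G) :
    m.apply ζ ∈ waterClosure G η := by
  refine map_mem_closure (f := fun ξ : V → ℝ => m.apply ξ) m.continuous_apply hζ ?_
  rintro _ ⟨l, rfl⟩
  exact ⟨l ++ [m], by simp [waterProfile]⟩

theorem waterProfile_induction {p : (V → ℝ) → Prop} {η : V → ℝ} (h0 : p η)
    (hm : ∀ ζ (m : WaterMove G), p ζ → p (m.apply ζ)) (moves : List (WaterMove G)) :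
    p (waterProfile η moves) := by
  induction moves generalizing η with
  | nil => exact h0
  | cons m l ih => exact ih (hm _ m h0)

theorem waterProfile_mem_Icc {η : V → ℝ} (hη : ∀ u, η u ∈ Set.Icc (0 : ℝ) 1)
    (moves : List (WaterMove G)) (u : V) : waterProfile η moves u ∈ Set.Icc (0 : ℝ) 1 :=
  waterProfile_induction (p := fun ζ : V → ℝ => ∀ u, ζ u ∈ Set.Icc (0 : ℝ) 1) hη
    (fun ζ m h _ => m.apply_mem_of_convex (convex_Icc 0 1) ζ (h _) (h _) (h _)) moves u

theorem waterClosure_mem_Icc {η ζ : V → ℝ} (hη : ∀ u, η u ∈ Set.Icc (0 : ℝ) 1)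
    (hζ : ζ ∈ waterClosure G η) (u : V) : ζ u ∈ Set.Icc (0 : ℝ) 1 := by
  have hc : IsClosed {ζ : V → ℝ | ζ u ∈ Set.Icc (0 : ℝ) 1} :=
    isClosed_Icc.preimage (continuous_apply u)
  refine closure_minimal ?_ hc hζ
  rintro _ ⟨l, rfl⟩
  exact waterProfile_mem_Icc hη l u

theorem le_waterKappa {η ζ : V → ℝ} (hη : ∀ u, η u ∈ Set.Icc (0 : ℝ) 1)
    (hζ : ζ ∈ waterClosure G η) (v : V) : ζ v ≤ waterKappa G η v := by
  have hc : IsClosed {ζ : V → ℝ | ζ v ≤ waterKappa G η v} :=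
    isClosed_Iic.preimage (continuous_apply v)
  refine closure_minimal ?_ hc hζ
  rintro _ ⟨l, rfl⟩
  have hb : BddAbove {r : ℝ | 0 ≤ r ∧ ∃ moves : List (WaterMove G), waterProfile η moves v = r} := by
    refine ⟨1, ?_⟩
    rintro r ⟨-, l', rfl⟩
    exact (waterProfile_mem_Icc hη l' v).2
  exact le_csSup hb ⟨(waterProfile_mem_Icc hη l v).1, l, rfl⟩

theorem waterKappa_le {η : V → ℝ} {v : V} {b : ℝ} (hb : 0 ≤ b)
    (h : ∀ moves : List (WaterMove G), waterProfile η moves v ≤ b) : waterKappa G η v ≤ b := by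
  refine Real.sSup_le ?_ hb
  rintro r ⟨-, l, rfl⟩
  exact h l

theorem waterKappa_le_one {η : V → ℝ} (hη : ∀ u, η u ∈ Set.Icc (0 : ℝ) 1) (v : V) :
    waterKappa G η v ≤ 1 :=
  waterKappa_le zero_le_one fun l => (waterProfile_mem_Icc hη l v).2

/-- Holds for every real profile because the default values match: `sSup` of an empty or unbounded
set is 0, and so is `toReal` of `⊤`. -/
theorem waterKappa_eq_toReal (η : V → ℝ) (v : V) :
    waterKappa G η v
      = (⨆ moves : List (WaterMove G), ENNReal.ofReal (waterProfile η moves v)).toReal := by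
  rw [ENNReal.toReal_iSup fun _ => ENNReal.ofReal_ne_top]
  simp only [ENNReal.toReal_ofReal']
  unfold waterKappa iSup
  set S := {r : ℝ | 0 ≤ r ∧ ∃ moves : List (WaterMove G), waterProfile η moves v = r}
  set T := Set.range fun moves : List (WaterMove G) => max (waterProfile η moves v) 0
  have hST : S ⊆ T := by
    rintro r ⟨hr, l, rfl⟩
    exact ⟨l, max_eq_left hr⟩
  have hTne : T.Nonempty := ⟨_, [], rfl⟩
  rcases S.eq_empty_or_nonempty with hS | hS
  · have hT : T = {0} := by
      refine Set.eq_singleton_iff_nonempty_unique_mem.2 ⟨hTne, ?_⟩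
      rintro _ ⟨l, rfl⟩
      refine max_eq_right (le_of_not_ge fun h => ?_)
      exact (Set.eq_empty_iff_forall_notMem.1 hS) _ ⟨h, l, rfl⟩
    rw [hS, hT, Real.sSup_empty, csSup_singleton]
  · have hub : upperBounds S = upperBounds T := by
      refine Set.Subset.antisymm (fun b hb => ?_) (upperBounds_mono_set hST)
      rintro _ ⟨l, rfl⟩
      obtain ⟨r, hr⟩ := hS
      have hb0 : 0 ≤ b := hr.1.trans (hb hr)
      refine max_le (le_of_not_gt fun hlt => ?_) hb0
      exact hlt.not_ge (hb ⟨hb0.trans hlt.le, l, rfl⟩)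
    by_cases hbdd : BddAbove S
    · have h1 := isLUB_csSup hS hbdd
      have h2 : IsLUB T (sSup S) := by rwa [IsLUB, ← hub]
      exact (h2.csSup_eq hTne).symm
    · have hbdd' : ¬ BddAbove T := by rwa [BddAbove, ← hub]
      rw [Real.sSup_of_not_bddAbove hbdd, Real.sSup_of_not_bddAbove hbdd']

theorem continuous_waterProfile (moves : List (WaterMove G)) :
    Continuous (fun η : V → ℝ => waterProfile η moves) := by
  induction moves with
  | nil => exact continuous_id
  | cons m l ih => exact ih.comp m.continuous_apply

/-- The fractions μ range over a continuum, so the supremum need not be countable. Lower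
semicontinuity of a supremum of continuous functions replaces countability. -/
theorem measurable_waterKappa [Countable V] (v : V) :
    Measurable (fun η : V → ℝ => waterKappa G η v) := by
  simp only [waterKappa_eq_toReal]
  refine ENNReal.measurable_toReal.comp (LowerSemicontinuous.measurable ?_)
  refine lowerSemicontinuous_iSup fun l => Continuous.lowerSemicontinuous ?_
  exact ENNReal.continuous_ofReal.comp ((continuous_apply v).comp (continuous_waterProfile l))

/-! ### Averaging over finite sets and raising a level by side branches. -/

/-- A finite vertex set on which every function that is constant along the edges of `G` inside the
set is constant: the set induces a connected subgraph. -/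
def EdgeRigid (G : SimpleGraph V) (S : Finset V) : Prop :=
  ∀ f : V → ℝ, (∀ a ∈ S, ∀ b ∈ S, G.Adj a b → f a = f b) → ∀ a ∈ S, ∀ b ∈ S, f a = f b

/-- Levels on a finite connected set can be equalised approximately. -/
theorem exists_average {η ζ : V → ℝ} (hη : ∀ u, η u ∈ Set.Icc (0 : ℝ) 1)
    (hζ : ζ ∈ waterClosure G η) {S : Finset V} (hS : EdgeRigid G S) :
    ∃ ξ ∈ waterClosure G η, (∀ u ∉ S, ξ u = ζ u) ∧
      ∀ u ∈ S, (S.card : ℝ) * ξ u = ∑ w ∈ S, ζ w := by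
  classical
  -- `C` is compact by Tychonoff, so it has a profile of minimal energy on `S`; a half move along an
  -- edge of `S` stays in `C` and would lower the energy if the two levels differed.
  set C : Set (V → ℝ) := Set.univ.pi (fun _ => Set.Icc (0 : ℝ) 1) ∩ (waterClosure G η ∩
    ({ξ | ∀ u ∉ S, ξ u = ζ u} ∩ {ξ | ∑ w ∈ S, ξ w = ∑ w ∈ S, ζ w})) with hC
  have hcomp : IsCompact C := by
    refine (isCompact_univ_pi fun _ => isCompact_Icc).inter_right ?_
    refine isClosed_closure.inter (IsClosed.inter ?_ ?_)
    · simp only [Set.ofPred_forall]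
      refine isClosed_iInter fun u => isClosed_iInter fun _ => ?_
      exact isClosed_eq (continuous_apply u) continuous_const
    · exact isClosed_eq (by fun_prop) continuous_const
  have hne : C.Nonempty :=
    ⟨ζ, fun u _ => waterClosure_mem_Icc hη hζ u, hζ, fun _ _ => rfl, rfl⟩
  obtain ⟨ξ, hξ, hmin⟩ := hcomp.exists_isMinOn hne
    (f := fun ξ : V → ℝ => ∑ w ∈ S, ξ w ^ 2) (by fun_prop)
  obtain ⟨hξI, hξK, hξo, hξs⟩ := hξ
  refine ⟨ξ, hξK, hξo, ?_⟩
  have hconst : ∀ a ∈ S, ∀ b ∈ S, ξ a = ξ b := by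
    refine hS ξ fun a ha b hb hab => ?_
    by_contra hne'
    let m : WaterMove G := ⟨a, b, hab, 1 / 2, by norm_num, le_rfl⟩
    have hmC : m.apply ξ ∈ C := by
      have hK := apply_mem_waterClosure hξK m
      refine ⟨fun u _ => waterClosure_mem_Icc hη hK u, hK, fun u hu => ?_, ?_⟩
      · rw [WaterMove.apply_of_ne, hξo u hu]
        · rintro rfl; exact hu ha
        · rintro rfl; exact hu hb
      · exact (m.sum_apply ξ S ha hb).trans hξs
    have h1 : ∑ w ∈ S, ξ w ^ 2 ≤ ∑ w ∈ S, m.apply ξ w ^ 2 := hmin hmC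
    rw [m.sum_sq_apply ξ S ha hb] at h1
    have h2 : 0 < (ξ a - ξ b) ^ 2 := by
      have := sub_ne_zero.2 hne'
      positivity
    have h3 : ∑ w ∈ S, ξ w ^ 2 ≤ ∑ w ∈ S, ξ w ^ 2 - 2 * (1 / 2) * (1 - 1 / 2) * (ξ a - ξ b) ^ 2 :=
      h1
    linarith
  intro u hu
  have hs : ∑ w ∈ S, ξ w = ∑ w ∈ S, ζ w := hξs
  rw [← hs, Finset.sum_congr rfl fun w hw => hconst w hw u hu]
  simp

theorem edgeRigid_image_range [DecidableEq V] {x : ℕ → V} {n : ℕ}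
    (hadj : ∀ i < n, G.Adj (x i) (x (i + 1))) :
    EdgeRigid G ((Finset.range (n + 1)).image x) := by
  intro f hf
  have h0 : ∀ i ≤ n, f (x i) = f (x 0) := by
    intro i
    induction i with
    | zero => intro _; rfl
    | succ i ih =>
      intro hi
      rw [← ih (by omega)]
      refine (hf _ ?_ _ ?_ (hadj i (by omega))).symm <;>
        exact Finset.mem_image_of_mem _ (Finset.mem_range.2 (by omega))
  intro a ha b hb
  obtain ⟨i, hi, rfl⟩ := Finset.mem_image.1 ha
  obtain ⟨j, hj, rfl⟩ := Finset.mem_image.1 hb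
  rw [Finset.mem_range] at hi hj
  rw [h0 i (by omega), h0 j (by omega)]

/-- A side branch at `x i` raises the common lower bound `a` of the levels on `x 0, …, x i`. -/
theorem exists_raise {η ζ : V → ℝ} (hη : ∀ u, η u ∈ Set.Icc (0 : ℝ) 1)
    (hζ : ζ ∈ waterClosure G η) {x : ℕ → V} {n : ℕ}
    (hadj : ∀ i < n, G.Adj (x i) (x (i + 1)))
    (hinj : Set.InjOn x (Set.Iic n)) {y : V} (hy : G.Adj (x n) y) (hyx : ∀ i ≤ n, x i ≠ y)
    {a ℓ : ℝ} (ha : ∀ i ≤ n, a ≤ ζ (x i)) (hℓ : ℓ ≤ ζ y) :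
    ∃ ξ ∈ waterClosure G η, (∀ i ≤ n, a + (ℓ - a) / (2 * (n + 1)) ≤ ξ (x i)) ∧
      ∀ u, u ≠ y → (∀ i ≤ n, u ≠ x i) → ξ u = ζ u := by
  classical
  -- The half move brings `x n` to at least `(a + ℓ) / 2`; spreading the gain `(ℓ - a) / 2` over `n
  -- + 1` sites gives the stated increment.
  let m : WaterMove G := ⟨x n, y, hy, 1 / 2, by norm_num, le_rfl⟩
  set S := (Finset.range (n + 1)).image x with hSdef
  have hxS : ∀ i ≤ n, x i ∈ S := fun i hi =>
    Finset.mem_image_of_mem _ (Finset.mem_range.2 (by omega))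
  have hcard : S.card = n + 1 := by
    rw [Finset.card_image_of_injOn, Finset.card_range]
    exact hinj.mono fun i hi => by
      have := Finset.mem_range.1 hi
      exact Set.mem_Iic.2 (by omega)
  obtain ⟨ξ, hξK, hξo, hξs⟩ := exists_average hη (apply_mem_waterClosure hζ m)
    (edgeRigid_image_range hadj)
  refine ⟨ξ, hξK, fun i hi => ?_, fun u huy hux => ?_⟩
  · have hsum : (n : ℝ) * a + (a + ℓ) / 2 ≤ ∑ w ∈ S, m.apply ζ w := by
      rw [Finset.sum_image (fun i hi j hj h => hinj (by
          have := Finset.mem_range.1 hi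
          exact Set.mem_Iic.2 (by omega)) (by
          have := Finset.mem_range.1 hj
          exact Set.mem_Iic.2 (by omega)) h), Finset.sum_range_succ]
      refine add_le_add ?_ ?_
      · have : ∀ i ∈ Finset.range n, a ≤ m.apply ζ (x i) := by
          intro i hi
          have hi := Finset.mem_range.1 hi
          rw [m.apply_of_ne]
          · exact ha i hi.le
          · intro h
            have := hinj (Set.mem_Iic.2 hi.le) (Set.mem_Iic.2 le_rfl) h
            omega
          · exact hyx i hi.le
        simpa using Finset.card_nsmul_le_sum _ _ _ this
      · have h1 : m.apply ζ (x n) = ζ (x n) + 1 / 2 * (ζ y - ζ (x n)) := m.apply_x ζ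
        have := ha n le_rfl
        rw [h1]
        linarith
    have h2 := hξs _ (hxS i hi)
    rw [hcard] at h2
    rw [← h2] at hsum
    push_cast at hsum
    have hn : (0 : ℝ) < n + 1 := by positivity
    have h3 : a + (ℓ - a) / (2 * (n + 1)) = ((n : ℝ) * a + (a + ℓ) / 2) / (n + 1) := by
      field_simp
      ring
    rw [h3, div_le_iff₀ hn]
    linarith
  · rw [hξo u, m.apply_of_ne]
    · exact hux n le_rfl
    · exact huy
    · intro hu
      obtain ⟨i, hi, rfl⟩ := Finset.mem_image.1 hu
      exact hux i (by have := Finset.mem_range.1 hi; omega) rfl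

/-- Along a path with side branches `y k` attached at `x (i k)`, the level at `x 0` can be
raised to `ℓ`, up to a product over those branches whose level is at least `ℓ`. -/
theorem waterKappa_ge_of_branches {η : V → ℝ} (hη : ∀ u, η u ∈ Set.Icc (0 : ℝ) 1)
    {x : ℕ → V} {N n : ℕ} (hadj : ∀ j < N, G.Adj (x j) (x (j + 1)))
    (hinj : Set.InjOn x (Set.Iic N)) {y : ℕ → V} {i : ℕ → ℕ} (hi : ∀ k < n, i k ≤ N)
    (hmono : ∀ k l, k ≤ l → l < n → i k ≤ i l)
    (hy : ∀ k < n, G.Adj (x (i k)) (y k)) (hyinj : ∀ k < n, ∀ l < n, y k = y l → k = l)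
    (hyx : ∀ k < n, ∀ j ≤ N, x j ≠ y k) (ℓ : ℝ) :
    ℓ - ℓ * ∏ k ∈ Finset.range n,
      (1 - (if ℓ ≤ η (y k) then (1 : ℝ) else 0) * (1 / (2 * (i k + 1)))) ≤
        waterKappa G η (x 0) := by
  -- Branches are used from the farthest to the nearest: using one raises the bound `a` on the whole
  -- initial segment up to it, hence at all nearer branch points, and leaves the other branches
  -- untouched.
  suffices H : ∀ n' ≤ n, ∀ ζ ∈ waterClosure G η, ∀ a : ℝ,
      a ≤ ζ (x 0) → (∀ k < n', ∀ j ≤ i k, a ≤ ζ (x j)) → (∀ k < n', ζ (y k) = η (y k)) →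
      ∃ ξ ∈ waterClosure G η, ℓ - (ℓ - a) * ∏ k ∈ Finset.range n',
      (1 - (if ℓ ≤ η (y k) then (1 : ℝ) else 0) * (1 / (2 * (i k + 1)))) ≤ ξ (x 0) by
    obtain ⟨ξ, hξ, hle⟩ := H n le_rfl η (self_mem_waterClosure η) 0 (hη _).1
      (fun _ _ _ _ => (hη _).1) (fun _ _ => rfl)
    rw [sub_zero] at hle
    exact hle.trans (le_waterKappa hη hξ _)
  intro n'
  induction n' with
  | zero =>
    intro _ ζ hζ a ha _ _
    exact ⟨ζ, hζ, by simpa using ha⟩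
  | succ k ih =>
    intro hk ζ hζ a ha0 ha hζy
    have hik := hi k (by omega)
    by_cases hgood : ℓ ≤ η (y k)
    · obtain ⟨ξ, hξ, hξa, hξo⟩ := exists_raise hη hζ (n := i k) (y := y k)
        (fun j hj => hadj j (by omega)) (hinj.mono (Set.Iic_subset_Iic.2 hik)) (hy k (by omega))
        (fun j hj => hyx k (by omega) j (by omega)) (a := a) (ℓ := ℓ)
        (fun j hj => ha k (by omega) j hj) (by rw [hζy k (by omega)]; exact hgood)
      obtain ⟨ξ', hξ', hle⟩ := ih (by omega) ξ hξ (a + (ℓ - a) / (2 * (i k + 1)))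
        (hξa 0 (by omega))
        (fun k' hk' j hj => hξa j (hj.trans (hmono k' k (by omega) (by omega))))
        (fun k' hk' => by
          rw [hξo, hζy k' (by omega)]
          · intro h
            have := hyinj k' (by omega) k (by omega) h
            omega
          · exact fun j hj h => hyx k' (by omega) j (by omega) h.symm)
      refine ⟨ξ', hξ', le_trans (le_of_eq ?_) hle⟩
      rw [Finset.prod_range_succ, if_pos hgood]
      ring
    · obtain ⟨ξ', hξ', hle⟩ := ih (by omega) ζ hζ a ha0 (fun k' hk' => ha k' (by omega))
        (fun k' hk' => hζy k' (by omega))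
      refine ⟨ξ', hξ', le_trans (le_of_eq ?_) hle⟩
      rw [Finset.prod_range_succ, if_neg hgood]
      ring

end Water

/-! ### Geodesics with side branches. -/

section Graph

variable {V : Type*} {G : SimpleGraph V}

theorem SimpleGraph.Connected.mem_of_adj_closed (hconn : G.Connected) {T : Set V} {u : V}
    (hu : u ∈ T) (hT : ∀ a ∈ T, ∀ b, G.Adj a b → b ∈ T) (w : V) : w ∈ T := by
  obtain ⟨p⟩ := hconn.preconnected u w
  induction p with
  | nil => exact hu
  | cons h q ih => exact ih (hT _ hu _ h)

theorem finite_setOf_dist_le (hconn : G.Connected) (hfin : ∀ u, (G.neighborSet u).Finite) (v : V)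
    (n : ℕ) : {u | G.dist v u ≤ n}.Finite := by
  induction n with
  | zero =>
    refine (Set.finite_singleton v).subset fun u hu => ?_
    have : G.dist v u = 0 := Nat.le_zero.1 hu
    exact ((hconn.dist_eq_zero_iff).1 this).symm
  | succ n ih =>
    refine ((ih.biUnion fun u _ => hfin u).union ih).subset fun u hu => ?_
    by_cases h : G.dist v u ≤ n
    · exact Or.inr h
    · left
      obtain ⟨p, hp⟩ := hconn.exists_walk_length_eq_dist u v
      have hu' : G.dist v u = n + 1 := le_antisymm hu (by omega)
      cases p with
      | nil => simp at hu'
      | @cons _ w _ hadj q =>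
        simp only [Set.mem_iUnion]
        refine ⟨w, ?_, hadj.symm⟩
        have h1 := SimpleGraph.dist_le q
        rw [SimpleGraph.Walk.length_cons, SimpleGraph.dist_comm] at hp
        rw [SimpleGraph.dist_comm] at h1
        show G.dist v w ≤ n
        omega

theorem countable_of_connected_of_finite_neighborSet (hconn : G.Connected)
    (hfin : ∀ u, (G.neighborSet u).Finite) : Countable V := by
  obtain ⟨v⟩ := hconn.nonempty
  rw [← Set.countable_univ_iff]
  refine (Set.countable_iUnion fun n => (finite_setOf_dist_le hconn hfin v n).countable).mono
    fun u _ => Set.mem_iUnion.2 ⟨G.dist v u, le_refl (G.dist v u)⟩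

/-- In an infinite, locally finite, connected graph there are arbitrarily long geodesics. -/
theorem exists_geodesic [Infinite V] (hconn : G.Connected) (hfin : ∀ u, (G.neighborSet u).Finite)
    (v : V) (N : ℕ) : ∃ x : ℕ → V, x 0 = v ∧ (∀ i < N, G.Adj (x i) (x (i + 1))) ∧
      ∀ i ≤ N, G.dist v (x i) = i := by
  obtain ⟨u, hu⟩ := (finite_setOf_dist_le hconn hfin v N).exists_notMem
  have hu : N < G.dist v u := not_le.1 hu
  obtain ⟨p, hp⟩ := hconn.exists_walk_length_eq_dist v u
  refine ⟨p.getVert, p.getVert_zero, fun i hi => p.adj_getVert_succ (by omega), fun i hi => ?_⟩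
  have h1 := SimpleGraph.dist_le (p.take i)
  have h2 := SimpleGraph.dist_le (p.drop i)
  have h3 := hconn.dist_triangle (u := v) (v := p.getVert i) (w := u)
  rw [SimpleGraph.Walk.take_length] at h1
  rw [SimpleGraph.Walk.drop_length] at h2
  omega

theorem dist_le_dist_add_one (hconn : G.Connected) (v : V) {a b : V} (h : G.Adj a b) :
    G.dist v a ≤ G.dist v b + 1 := by
  have h1 := hconn.dist_triangle (u := v) (v := b) (w := a)
  rw [SimpleGraph.dist_eq_one_iff_adj.2 h.symm] at h1
  exact h1

theorem exists_bounded_dist_of_quasiTransitive (hconn : G.Connected) (hqt : G.IsQuasiTransitive)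
    {p : V → Prop} (hp : ∀ (f : G ≃g G) u, p u → p (f u)) {w : V} (hw : p w) :
    ∃ R : ℕ, ∀ u, ∃ w', p w' ∧ G.dist u w' ≤ R := by
  obtain ⟨n, c, hc⟩ := hqt
  have h : ∀ i : Fin n, ∃ R : ℕ, ∀ u, c u = i → ∃ w', p w' ∧ G.dist u w' ≤ R := by
    intro i
    by_cases hi : ∃ u₀, c u₀ = i
    · obtain ⟨u₀, rfl⟩ := hi
      refine ⟨G.dist u₀ w, fun u hu => ?_⟩
      obtain ⟨f, rfl⟩ := hc u₀ u hu.symm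
      refine ⟨f w, hp f w hw, ?_⟩
      obtain ⟨q, hq⟩ := hconn.exists_walk_length_eq_dist u₀ w
      rw [← hq]
      simpa using SimpleGraph.dist_le (q.map f.toHom)
    · exact ⟨0, fun u hu => (hi ⟨u, hu⟩).elim⟩
  choose R hR using h
  refine ⟨Finset.univ.sup R, fun u => ?_⟩
  obtain ⟨w', hw', hd⟩ := hR (c u) u rfl
  exact ⟨w', hw', hd.trans (Finset.le_sup (Finset.mem_univ _))⟩

theorem encard_neighborSet_iso (f : G ≃g G) (u : V) :
    (G.neighborSet (f u)).encard = (G.neighborSet u).encard := by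
  have : G.neighborSet (f u) = f '' G.neighborSet u := by
    ext w
    constructor
    · intro hw
      refine ⟨f.symm w, ?_, f.apply_symm_apply w⟩
      rw [SimpleGraph.mem_neighborSet] at hw ⊢
      rw [← f.map_adj_iff]
      simpa using hw
    · rintro ⟨w', hw', rfl⟩
      exact f.map_adj_iff.2 hw'
  rw [this, f.injective.encard_image]

/-- Near a vertex whose degree is not two, a geodesic has a side branch. -/
theorem exists_branch (hconn : G.Connected) {R : ℕ}
    (hR : ∀ u, ∃ w, (G.neighborSet w).encard ≠ 2 ∧ G.dist u w ≤ R) {v : V} {x : ℕ → V} {N : ℕ}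
    (hadj : ∀ i < N, G.Adj (x i) (x (i + 1))) (hd : ∀ i ≤ N, G.dist v (x i) = i) {m : ℕ}
    (hm : R + 1 ≤ m) (hmN : m + R + 1 ≤ N) :
    ∃ j y, m ≤ j + R ∧ j ≤ m + R ∧ G.Adj (x j) y ∧ ∀ i ≤ N, x i ≠ y := by
  by_contra! hno
  have hnb : ∀ j, m ≤ j + R → j ≤ m + R → G.neighborSet (x j) = {x (j - 1), x (j + 1)} := by
    intro j h1 h2
    ext y
    rw [SimpleGraph.mem_neighborSet, Set.mem_insert_iff, Set.mem_singleton_iff]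
    constructor
    · intro hy
      obtain ⟨i, hi, rfl⟩ := hno j y h1 h2 hy
      have h3 := dist_le_dist_add_one hconn v hy
      have h4 := dist_le_dist_add_one hconn v hy.symm
      rw [hd i hi, hd j (by omega)] at h3 h4
      have h5 : i ≠ j := by rintro rfl; exact hy.ne rfl
      have h6 : i = j - 1 ∨ i = j + 1 := by omega
      exact h6.imp (congrArg x) (congrArg x)
    · rintro (rfl | rfl)
      · have := hadj (j - 1) (by omega)
        rw [Nat.sub_add_cancel (by omega)] at this
        exact this.symm
      · exact hadj j (by omega)
  -- Without a branch near `x m`, walks of length at most `R` from `x m` cannot leave the geodesic,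
  -- so the nearby vertex of degree other than two would lie on it and have exactly two neighbours.
  have hreach : ∀ r j, j + r ≤ m + R → m + r ≤ j + R → ∀ w (p : G.Walk (x j) w), p.length = r →
      ∃ i, m ≤ i + R ∧ i ≤ m + R ∧ w = x i := by
    intro r
    induction r with
    | zero =>
      intro j h1 h2 w p hp
      exact ⟨j, by omega, by omega, (SimpleGraph.Walk.eq_of_length_eq_zero hp).symm⟩
    | succ r ih =>
      intro j h1 h2 w p hp
      cases p with
      | nil => simp at hp
      | @cons _ u _ h q =>
        have hq : q.length = r := by simpa using hp
        have hu : u ∈ ({x (j - 1), x (j + 1)} : Set V) := by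
          rw [← hnb j (by omega) (by omega)]
          exact h
        rcases hu with rfl | rfl
        · exact ih (j - 1) (by omega) (by omega) w q hq
        · exact ih (j + 1) (by omega) (by omega) w q hq
  obtain ⟨w, hw, hdw⟩ := hR (x m)
  obtain ⟨p, hp⟩ := hconn.exists_walk_length_eq_dist (x m) w
  obtain ⟨i, h1, h2, rfl⟩ := hreach p.length m (by omega) (by omega) w p rfl
  refine hw ?_
  rw [hnb i h1 h2, Set.encard_pair]
  intro h
  have h3 := hd (i - 1) (by omega)
  rw [h, hd (i + 1) (by omega)] at h3
  omega

/-- If some vertex of a quasi-transitive infinite graph does not have degree two, then there are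
arbitrarily long paths from `v` with side branches at linearly growing positions. -/
theorem exists_path_with_branches [Infinite V] (hconn : G.Connected)
    (hfin : ∀ u, (G.neighborSet u).Finite) (hqt : G.IsQuasiTransitive)
    (hw : ∃ w, (G.neighborSet w).encard ≠ 2) (v : V) :
    ∃ C : ℕ, ∀ n : ℕ, ∃ (N : ℕ) (x : ℕ → V) (i : ℕ → ℕ) (y : ℕ → V), x 0 = v ∧
      (∀ j < N, G.Adj (x j) (x (j + 1))) ∧ Set.InjOn x (Set.Iic N) ∧
      (∀ k < n, i k ≤ N ∧ i k + 1 ≤ C * (k + 1)) ∧ (∀ k l, k ≤ l → l < n → i k ≤ i l) ∧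
      (∀ k < n, G.Adj (x (i k)) (y k)) ∧ (∀ k < n, ∀ l < n, y k = y l → k = l) ∧
      ∀ k < n, ∀ j ≤ N, x j ≠ y k := by
  obtain ⟨w, hw⟩ := hw
  obtain ⟨R, hR⟩ := exists_bounded_dist_of_quasiTransitive hconn hqt
    (p := fun u => (G.neighborSet u).encard ≠ 2)
    (fun f u h => by rwa [encard_neighborSet_iso]) hw
  -- Each branch point lies within `R` of its centre `(2R+4)k + R + 1`, so this spacing keeps branch
  -- points at least 3 apart. Since `y k` is at distance at most 1 from `x (i k)`, the `y k` are
  -- then distinct.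
  refine ⟨2 * R + 4, fun n => ?_⟩
  obtain ⟨x, hx0, hadj, hd⟩ := exists_geodesic hconn hfin v ((2 * R + 4) * n)
  have hb : ∀ k, ∃ j y, k < n → ((2 * R + 4) * k + (R + 1) ≤ j + R ∧
      j ≤ (2 * R + 4) * k + (R + 1) + R ∧ G.Adj (x j) y ∧ ∀ i ≤ (2 * R + 4) * n, x i ≠ y) := by
    intro k
    by_cases hk : k < n
    · have h1 : (2 * R + 4) * (k + 1) ≤ (2 * R + 4) * n := Nat.mul_le_mul_left _ hk
      rw [Nat.mul_succ] at h1
      obtain ⟨j, y, h⟩ := exists_branch hconn hR hadj hd (m := (2 * R + 4) * k + (R + 1))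
        (by omega) (by omega)
      exact ⟨j, y, fun _ => h⟩
    · exact ⟨0, v, fun h => (hk h).elim⟩
  choose i y h using hb
  have hle : ∀ k < n, i k + 1 ≤ (2 * R + 4) * (k + 1) := fun k hk => by
    have := (h k hk).2.1
    rw [Nat.mul_succ]
    omega
  have hgap : ∀ k l, k < l → l < n → i k + 3 ≤ i l := fun k l hkl hl => by
    have h1 := (h k (by omega)).2.1
    have h2 := (h l hl).1
    have h3 : (2 * R + 4) * (k + 1) ≤ (2 * R + 4) * l := Nat.mul_le_mul_left _ hkl
    rw [Nat.mul_succ] at h3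
    omega
  have hleN : ∀ k < n, i k ≤ (2 * R + 4) * n := fun k hk => by
    have h1 : (2 * R + 4) * (k + 1) ≤ (2 * R + 4) * n := Nat.mul_le_mul_left _ hk
    have := hle k hk
    omega
  have hy2 : ∀ k l, k < l → l < n → y k ≠ y l := fun k l hkl hl hy => by
    have h1 := dist_le_dist_add_one hconn v (h k (by omega)).2.2.1.symm
    have h2 := dist_le_dist_add_one hconn v (h l hl).2.2.1
    rw [hd _ (hleN _ (by omega))] at h1
    rw [hd _ (hleN _ hl)] at h2
    rw [hy] at h1
    have := hgap k l hkl hl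
    omega
  refine ⟨(2 * R + 4) * n, x, i, y, hx0, hadj, fun a ha b hb hab => ?_,
    fun k hk => ⟨hleN k hk, hle k hk⟩, fun k l hkl hl => ?_, fun k hk => (h k hk).2.2.1,
    fun k hk l hl hkl => ?_, fun k hk j hj => (h k hk).2.2.2 j hj⟩
  · have h1 := hd a ha
    rw [hab, hd b hb] at h1
    exact h1.symm
  · rcases hkl.eq_or_lt with rfl | hkl
    · rfl
    · have := hgap k l hkl hl
      omega
  · rcases lt_trichotomy k l with hlt | heq | hlt
    · exact (hy2 k l hlt hl hkl).elim
    · exact heq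
    · exact (hy2 l k hlt hk hkl.symm).elim

/-! ### Recognising the two-sided path. -/

theorem isTwoSidedPath_of_sequence [Infinite V] (hconn : G.Connected) {e : ℤ → V}
    (h1 : ∀ n, G.Adj (e n) (e (n + 1)))
    (h2 : ∀ n c, G.Adj (e n) c → c = e (n - 1) ∨ c = e (n + 1))
    (h3 : ∀ n, e (n - 1) ≠ e (n + 1)) : G.IsTwoSidedPath := by
  have h1' : ∀ n, G.Adj (e n) (e (n - 1)) := fun n => by
    have := (h1 (n - 1)).symm
    rwa [sub_add_cancel] at this
  have hsurj : Function.Surjective e := fun w =>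
    hconn.mem_of_adj_closed (T := Set.range e) ⟨0, rfl⟩ (by
      rintro _ ⟨n, rfl⟩ b hb
      rcases h2 n b hb with rfl | rfl <;> exact ⟨_, rfl⟩) w
  have hne : ∀ a b, a < b → e a ≠ e b := by
    intro a b hab heq
    -- If `e a = e b`, the sequence either retraces itself from both ends, which fails at the
    -- midpoint by `h3` or looplessness, or it closes into a cycle, whose finite vertex set is
    -- closed under adjacency and so is all of `V`.
    by_cases hc : e (a + 1) = e (b - 1)
    · have hrefl : ∀ k : ℕ, e (a + k) = e (b - k) ∧ e (a + k + 1) = e (b - k - 1) := by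
        intro k
        induction k with
        | zero => simpa using ⟨heq, hc⟩
        | succ k ih =>
          have e1 : a + ((k + 1 : ℕ) : ℤ) = a + k + 1 := by push_cast; ring
          have e2 : b - ((k + 1 : ℕ) : ℤ) = b - k - 1 := by push_cast; ring
          rw [e1, e2]
          refine ⟨ih.2, ?_⟩
          have h4 := h1 (a + k + 1)
          rw [ih.2] at h4
          rcases h2 _ _ h4 with h5 | h5
          · exact h5
          · rw [sub_add_cancel, ← ih.1] at h5
            have h6 := h3 (a + k + 1)
            rw [add_sub_cancel_right] at h6
            exact (h6 h5.symm).elim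
      obtain ⟨k, hk⟩ : ∃ k : ℕ, b - a = 2 * k ∨ b - a = 2 * k + 1 :=
        ⟨((b - a) / 2).toNat, by omega⟩
      obtain ⟨h4, h5⟩ := hrefl k
      rcases hk with hk | hk
      · have e1 : b - k - 1 = a + k - 1 := by omega
        rw [e1] at h5
        exact h3 _ h5.symm
      · have e1 : b - k = a + k + 1 := by omega
        rw [e1] at h4
        exact (h1 (a + k)).ne h4
    · have hT : ∀ w, w ∈ e '' Set.Icc a b := by
        refine hconn.mem_of_adj_closed (Set.mem_image_of_mem e (Set.left_mem_Icc.2 hab.le)) ?_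
        have hmem : ∀ j, a ≤ j → j ≤ b → e j ∈ e '' Set.Icc a b := fun j ha hb =>
          Set.mem_image_of_mem e ⟨ha, hb⟩
        have ha1 : e (a - 1) = e (b - 1) := by
          have h4 := h1' b
          rw [← heq] at h4
          rcases h2 a _ h4 with h5 | h5
          · exact h5.symm
          · exact (hc h5.symm).elim
        have hend : ∀ c, G.Adj (e a) c → c ∈ e '' Set.Icc a b := by
          intro c hc'
          rcases h2 a c hc' with rfl | rfl
          · rw [ha1]
            exact hmem _ (by omega) (by omega)
          · exact hmem _ (by omega) (by omega)
        rintro _ ⟨j, ⟨hja, hjb⟩, rfl⟩ c hc'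
        rcases hja.eq_or_lt with rfl | hja
        · exact hend c hc'
        · rcases hjb.eq_or_lt with rfl | hjb
          · exact hend c (heq ▸ hc')
          · rcases h2 j c hc' with rfl | rfl
            · exact hmem _ (by omega) (by omega)
            · exact hmem _ (by omega) (by omega)
      have hfinV : (Set.univ : Set V).Finite :=
        ((Set.finite_Icc a b).image e).subset fun w _ => hT w
      exact Set.infinite_univ hfinV
  have hinj : Function.Injective e := fun a b hab => by
    rcases lt_trichotomy a b with h | h | h
    · exact (hne a b h hab).elim
    · exact h
    · exact (hne b a h hab.symm).elim
  refine ⟨SimpleGraph.Iso.symm ⟨Equiv.ofBijective e ⟨hinj, hsurj⟩, ?_⟩⟩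
  intro a b
  show G.Adj (e a) (e b) ↔ b = a + 1 ∨ a = b + 1
  constructor
  · intro h
    rcases h2 a _ h with h4 | h4
    · right
      have := hinj h4
      omega
    · exact Or.inl (hinj h4)
  · rintro (rfl | rfl)
    · exact h1 a
    · exact (h1 b).symm

theorem isTwoSidedPath_of_encard_neighborSet [Infinite V] (hconn : G.Connected)
    (h : ∀ w, (G.neighborSet w).encard = 2) : G.IsTwoSidedPath := by
  have hex : ∀ a b, ∃ c, G.Adj a b → G.Adj b c ∧ c ≠ a ∧ ∀ d, G.Adj b d → d = a ∨ d = c := by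
    intro a b
    by_cases hab : G.Adj a b
    · obtain ⟨p, q, hpq, hs⟩ := Set.encard_eq_two.1 (h b)
      have hmem : ∀ d, G.Adj b d ↔ d = p ∨ d = q := fun d => by
        rw [← SimpleGraph.mem_neighborSet, hs]
        simp
      rcases (hmem a).1 hab.symm with rfl | rfl
      · exact ⟨q, fun _ => ⟨(hmem q).2 (Or.inr rfl), hpq.symm, fun d hd => (hmem d).1 hd⟩⟩
      · exact ⟨p, fun _ => ⟨(hmem p).2 (Or.inl rfl), hpq, fun d hd => ((hmem d).1 hd).symm⟩⟩
    · exact ⟨a, fun h => (hab h).elim⟩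
  choose nxt hnxt using hex
  have hback : ∀ a b, G.Adj a b → nxt (nxt a b) b = a := fun a b hab => by
    have h1 := hnxt a b hab
    rcases (hnxt (nxt a b) b h1.1.symm).2.2 a hab.symm with h2 | h2
    · exact (h1.2.1 h2.symm).elim
    · exact h2.symm
  -- The non-backtracking step on directed edges is invertible, so its integer powers give a
  -- sequence indexed by ℤ at once.
  let σ : Equiv.Perm {p : V × V // G.Adj p.1 p.2} :=
    { toFun := fun p => ⟨(p.1.2, nxt p.1.1 p.1.2), (hnxt _ _ p.2).1⟩
      invFun := fun p => ⟨(nxt p.1.2 p.1.1, p.1.1), (hnxt _ _ p.2.symm).1.symm⟩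
      left_inv := fun p => Subtype.ext (Prod.ext (hback _ _ p.2) rfl)
      right_inv := fun p => Subtype.ext (Prod.ext rfl (hback _ _ p.2.symm)) }
  obtain ⟨v⟩ := hconn.nonempty
  obtain ⟨w, w', -, hw⟩ := Set.encard_eq_two.1 (h v)
  have hvw : G.Adj v w := by
    rw [← SimpleGraph.mem_neighborSet, hw]
    simp
  set e : ℤ → V := fun n => ((σ ^ n) ⟨(v, w), hvw⟩).1.1 with he
  have hsucc : ∀ n : ℤ, (σ ^ (n + 1)) ⟨(v, w), hvw⟩ = σ ((σ ^ n) ⟨(v, w), hvw⟩) := fun n => by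
    rw [add_comm, zpow_one_add, Equiv.Perm.mul_apply]
  have he1 : ∀ n, e (n + 1) = ((σ ^ n) ⟨(v, w), hvw⟩).1.2 := fun n => by
    simp only [he, hsucc]
    rfl
  have hadj : ∀ n, G.Adj (e n) (e (n + 1)) := fun n => by
    rw [he1]
    exact ((σ ^ n) ⟨(v, w), hvw⟩).2
  have he2 : ∀ n, e (n + 1) = nxt (e (n - 1)) (e n) := fun n => by
    have h1 := hsucc (n - 1)
    have h2 := he1 (n - 1)
    rw [sub_add_cancel] at h1 h2
    rw [he1, h1, h2]
    rfl
  have hadj' : ∀ n, G.Adj (e (n - 1)) (e n) := fun n => by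
    have := hadj (n - 1)
    rwa [sub_add_cancel] at this
  refine isTwoSidedPath_of_sequence hconn hadj (fun n c hc => ?_) fun n => ?_
  · rw [he2]
    exact (hnxt _ _ (hadj' n)).2.2 c hc
  · rw [he2]
    exact (hnxt _ _ (hadj' n)).2.1.symm

end Graph

/-! ### Potentials on integer intervals. -/

section Path

theorem sum_Ico_int_succ_top {i j : ℤ} (hij : i ≤ j) (f : ℤ → ℝ) :
    ∑ u ∈ Finset.Ico i (j + 1), f u = ∑ u ∈ Finset.Ico i j, f u + f j := by
  have : Finset.Ico i (j + 1) = insert j (Finset.Ico i j) := by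
    ext u
    simp only [Finset.mem_Ico, Finset.mem_insert]
    omega
  rw [this, Finset.sum_insert (by simp), add_comm]

theorem sum_Ico_int_pred_bot {i j : ℤ} (hij : i ≤ j) (f : ℤ → ℝ) :
    ∑ u ∈ Finset.Ico (i - 1) j, f u = ∑ u ∈ Finset.Ico i j, f u + f (i - 1) := by
  have : Finset.Ico (i - 1) j = insert (i - 1) (Finset.Ico i j) := by
    ext u
    simp only [Finset.mem_Ico, Finset.mem_insert]
    omega
  rw [this, Finset.sum_insert (by simp), add_comm]

/-- A separately concave upper bound for the water content of intervals survives an exchange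
between two neighbouring sites. -/
theorem sum_Ico_exchange_le {Φ : ℤ → ℤ → ℝ}
    (hright : ∀ i j, i < j → Φ i (j + 1) + Φ i (j - 1) ≤ 2 * Φ i j)
    (hleft : ∀ i j, i < j → Φ (i - 1) j + Φ (i + 1) j ≤ 2 * Φ i j)
    {f f' : ℤ → ℝ} (hf : ∀ i j, i ≤ j → ∑ u ∈ Finset.Ico i j, f u ≤ Φ i j) {a : ℤ} {μ : ℝ}
    (hμ : 0 ≤ μ) (hμ' : μ ≤ 1 / 2)
    (hf' : ∀ u, f' u = f u + (if u = a then μ * (f (a + 1) - f a) else 0)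
      + (if u = a + 1 then μ * (f a - f (a + 1)) else 0))
    {i j : ℤ} (hij : i ≤ j) : ∑ u ∈ Finset.Ico i j, f' u ≤ Φ i j := by
  -- Only intervals separating `a` from `a + 1` change content. With s(i, j) the content of [i, j),
  -- the new value of s(i, a+1) is (1 - 2μ) s(i, a+1) + μ (s(i, a+2) + s(i, a)), a convex
  -- combination as μ ≤ 1/2, so concavity in the endpoint bounds it.
  simp only [hf', Finset.sum_add_distrib, Finset.sum_ite_eq', Finset.mem_Ico]
  have h0 := hf i j hij
  by_cases h1 : i ≤ a ∧ a < j
  · by_cases h2 : i ≤ a + 1 ∧ a + 1 < j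
    · rw [if_pos h1, if_pos h2]
      linarith
    · obtain rfl : j = a + 1 := by omega
      rw [if_pos h1, if_neg h2]
      have h3 := hf i (a + 1 + 1) (by omega)
      have h4 := hf i a h1.1
      have h5 := hright i (a + 1) (by omega)
      rw [add_sub_cancel_right] at h5
      rw [sum_Ico_int_succ_top (by omega), sum_Ico_int_succ_top (by omega)] at h3
      rw [sum_Ico_int_succ_top (by omega)] at h0 ⊢
      nlinarith
  · by_cases h2 : i ≤ a + 1 ∧ a + 1 < j
    · obtain rfl : i = a + 1 := by omega
      rw [if_neg h1, if_pos h2]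
      have h3 := hf (a + 1 - 1) j (by omega)
      have h4 := hf (a + 1 + 1) j (by omega)
      have h5 := hleft (a + 1) j (by omega)
      have h6 := sum_Ico_int_pred_bot (i := a + 1 + 1) (j := j) (by omega) f
      rw [add_sub_cancel_right] at h6
      rw [sum_Ico_int_pred_bot (by omega)] at h3
      rw [add_sub_cancel_right] at h3 h5
      rw [h6] at h0 h3 ⊢
      nlinarith
    · rw [if_neg h1, if_neg h2]
      linarith

theorem waterKappa_le_of_separately_concave {V : Type*} {G : SimpleGraph V} (e : ℤ ≃ V)
    (he : ∀ a b, G.Adj (e a) (e b) ↔ b = a + 1 ∨ a = b + 1) {Φ : ℤ → ℤ → ℝ}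
    (hright : ∀ i j, i < j → Φ i (j + 1) + Φ i (j - 1) ≤ 2 * Φ i j)
    (hleft : ∀ i j, i < j → Φ (i - 1) j + Φ (i + 1) j ≤ 2 * Φ i j)
    {η : V → ℝ} (hη : ∀ i j, i ≤ j → ∑ u ∈ Finset.Ico i j, η (e u) ≤ Φ i j) (h01 : 0 ≤ Φ 0 1) :
    waterKappa G η (e 0) ≤ Φ 0 1 := by
  refine waterKappa_le h01 fun l => ?_
  have key : ∀ i j, i ≤ j → ∑ u ∈ Finset.Ico i j, waterProfile η l (e u) ≤ Φ i j := by
    refine waterProfile_induction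
      (p := fun ζ : V → ℝ => ∀ i j, i ≤ j → ∑ u ∈ Finset.Ico i j, ζ (e u) ≤ Φ i j) hη ?_ l
    intro ζ m hζ i j hij
    obtain ⟨a, ha⟩ := e.surjective m.x
    obtain ⟨b, hb⟩ := e.surjective m.y
    have hab := m.adj
    rw [← ha, ← hb, he] at hab
    have happ : ∀ u, m.apply ζ (e u) = if u = a then ζ (e a) + m.μ * (ζ (e b) - ζ (e a))
        else if u = b then ζ (e b) + m.μ * (ζ (e a) - ζ (e b)) else ζ (e u) := by
      intro u
      simp only [WaterMove.apply, ← ha, ← hb, e.injective.eq_iff]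
    rcases hab with rfl | rfl
    · refine sum_Ico_exchange_le hright hleft hζ m.μ_pos.le m.μ_le (a := a) (fun u => ?_) hij
      rw [happ]
      by_cases h1 : u = a
      · subst h1
        simp
      · by_cases h2 : u = a + 1
        · subst h2
          simp
        · simp [h1, h2]
    · refine sum_Ico_exchange_le hright hleft hζ m.μ_pos.le m.μ_le (a := b) (fun u => ?_) hij
      rw [happ]
      by_cases h1 : u = b
      · subst h1
        simp
      · by_cases h2 : u = b + 1
        · subst h2
          simp
        · simp [h1, h2]
  have h := key 0 1 zero_le_one
  rwa [show Finset.Ico (0 : ℤ) 1 = {0} from rfl, Finset.sum_singleton] at h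

theorem sqrt_sub_one_add_sqrt_add_one_le {y : ℝ} (hy : 1 ≤ y) :
    √(y - 1) + √(y + 1) ≤ 2 * √y := by
  have h1 := Real.sq_sqrt (show 0 ≤ y - 1 by linarith)
  have h2 := Real.sq_sqrt (show 0 ≤ y + 1 by linarith)
  have h3 := Real.sq_sqrt (show 0 ≤ y by linarith)
  refine abs_le_of_sq_le_sq' ?_ (by positivity) |>.2
  nlinarith [sq_nonneg (√(y - 1) - √(y + 1))]

theorem sqrt_add_one_le {y : ℝ} (hy : 0 < y) : √(y + 1) ≤ √y + 1 / (2 * √y) := by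
  have h3 := Real.sq_sqrt hy.le
  have hs : 0 < √y := Real.sqrt_pos.2 hy
  refine Real.sqrt_le_iff.2 ⟨by positivity, ?_⟩
  have : (√y + 1 / (2 * √y)) ^ 2 = √y ^ 2 + 1 + (1 / (2 * √y)) ^ 2 := by
    field_simp
    ring
  rw [this, h3]
  nlinarith [sq_nonneg (1 / (2 * √y))]

theorem two_div_sqrt_le {y : ℝ} (hy : 1 < y) :
    2 / √y ≤ 1 / √(y - 1) + 1 / √(y + 1) := by
  have ha : 0 < √(y - 1) := Real.sqrt_pos.2 (by linarith)
  have hb : 0 < √(y + 1) := Real.sqrt_pos.2 (by linarith)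
  have hc : 0 < √y := Real.sqrt_pos.2 (by linarith)
  have h := sqrt_sub_one_add_sqrt_add_one_le hy.le
  rw [div_add_div _ _ ha.ne' hb.ne', div_le_div_iff₀ hc (by positivity)]
  have h4 : 0 < √(y - 1) + √(y + 1) := by positivity
  nlinarith [sq_nonneg (√(y - 1) - √(y + 1)), mul_pos ha hb]

/-- The part of `sqrtWeight` on intervals that do not contain the origin in their interior. -/
noncomputable def sqrtWeightAux (a b : ℤ) : ℝ :=
  -- This is the tangent at `b = 0` to `b ↦ 1 / 2 * √(a - b + 1)`.
  1 / 2 * (√((a : ℝ) + 1) - b * (1 / (2 * √((a : ℝ) + 1))))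

/-- A separately concave function of integer intervals `[i, j)` which is small at `[0, 1)` and
tends to infinity along the diagonal. -/
noncomputable def sqrtWeight (i j : ℤ) : ℝ :=
  -- The bare root of the length would stay bounded on short intervals far from the origin.
  -- Continuing it linearly in the endpoint nearer to the origin keeps concavity and yields growth
  -- there.
  if 0 ≤ i then sqrtWeightAux j i
  else if j ≤ 0 then sqrtWeightAux (-i) (-j)
  else 1 / 2 * √((j : ℝ) - i + 1)

/-- Reflection reduces concavity in the left endpoint to the right one. -/
theorem sqrtWeight_neg_neg {i j : ℤ} (hij : i ≤ j) :
    sqrtWeight (-j) (-i) = sqrtWeight i j := by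
  unfold sqrtWeight
  by_cases h1 : 0 ≤ i
  · rw [if_pos h1]
    by_cases h2 : 0 ≤ -j
    · obtain rfl : i = 0 := by omega
      obtain rfl : j = 0 := by omega
      simp
    · rw [if_neg h2, if_pos (by omega), neg_neg, neg_neg]
  · rw [if_neg h1]
    by_cases h2 : j ≤ 0
    · rw [if_pos h2, if_pos (by omega)]
    · rw [if_neg h2, if_neg (by omega), if_neg (by omega)]
      push_cast
      ring_nf

theorem sqrtWeight_concave_right {i j : ℤ} (hij : i < j) :
    sqrtWeight i (j + 1) + sqrtWeight i (j - 1) ≤ 2 * sqrtWeight i j := by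
  unfold sqrtWeight
  by_cases h1 : 0 ≤ i
  · simp only [if_pos h1]
    unfold sqrtWeightAux
    have hj : (1 : ℝ) ≤ j := by exact_mod_cast (by omega : (1 : ℤ) ≤ j)
    have hi : (0 : ℝ) ≤ i := by exact_mod_cast h1
    have e1 := sqrt_sub_one_add_sqrt_add_one_le (y := (j : ℝ) + 1) (by linarith)
    have e2 := mul_le_mul_of_nonneg_left (two_div_sqrt_le (y := (j : ℝ) + 1) (by linarith)) hi
    have e3 : ((j - 1 : ℤ) : ℝ) + 1 = (j : ℝ) + 1 - 1 := by push_cast; ring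
    have e4 : ((j + 1 : ℤ) : ℝ) + 1 = (j : ℝ) + 1 + 1 := by push_cast; ring
    rw [e3, e4]
    have e5 : ∀ s : ℝ, 1 / (2 * s) = 1 / 2 * (1 / s) := fun s => by
      rw [one_div_mul_one_div]
    rw [e5, e5, e5]
    have e6 : 2 / √((j : ℝ) + 1) = 2 * (1 / √((j : ℝ) + 1)) := by ring
    rw [e6] at e2
    nlinarith
  · simp only [if_neg h1]
    have hi : (i : ℝ) ≤ -1 := by exact_mod_cast (by omega : i ≤ -1)
    rcases lt_trichotomy j 0 with hj | rfl | hj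
    · rw [if_pos (by omega), if_pos (by omega), if_pos (by omega)]
      unfold sqrtWeightAux
      push_cast
      linarith
    · rw [if_neg (by omega), if_pos (by omega), if_pos (by omega)]
      unfold sqrtWeightAux
      -- At `j = 0` the linear piece meets the root; the root lies below its tangent.
      have e1 := sqrt_add_one_le (y := -(i : ℝ) + 1) (by linarith)
      have e2 : ((0 + 1 : ℤ) : ℝ) - i + 1 = -(i : ℝ) + 1 + 1 := by push_cast; ring
      rw [e2]
      push_cast
      linarith
    · have hj' : (1 : ℝ) ≤ j := by exact_mod_cast (by omega : (1 : ℤ) ≤ j)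
      have e1 := sqrt_sub_one_add_sqrt_add_one_le (y := (j : ℝ) - i + 1) (by linarith)
      have e2 : ((j + 1 : ℤ) : ℝ) - i + 1 = (j : ℝ) - i + 1 + 1 := by push_cast; ring
      have e3 : (if j - 1 ≤ 0 then sqrtWeightAux (-i) (-(j - 1))
          else 1 / 2 * √(((j - 1 : ℤ) : ℝ) - i + 1)) = 1 / 2 * √((j : ℝ) - i + 1 - 1) := by
        have e4 : (j : ℝ) - i + 1 - 1 = ((j - 1 : ℤ) : ℝ) - i + 1 := by push_cast; ring
        rw [e4]
        split_ifs with h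
        · obtain rfl : j = 1 := by omega
          unfold sqrtWeightAux
          have e5 : ((1 - 1 : ℤ) : ℝ) - i + 1 = ((-i : ℤ) : ℝ) + 1 := by push_cast; ring
          rw [e5]
          simp
        · rfl
      rw [if_neg (by omega), if_neg (by omega : ¬ j ≤ 0), e3, e2]
      linarith

theorem sqrtWeight_concave_left {i j : ℤ} (hij : i < j) :
    sqrtWeight (i - 1) j + sqrtWeight (i + 1) j ≤ 2 * sqrtWeight i j := by
  have h := sqrtWeight_concave_right (i := -j) (j := -i) (by omega)
  rw [sqrtWeight_neg_neg hij.le, show -i + 1 = -(i - 1) by ring, show -i - 1 = -(i + 1) by ring,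
    sqrtWeight_neg_neg (by omega), sqrtWeight_neg_neg (by omega)] at h
  exact h

theorem le_sqrtWeight_of_nonneg {i j : ℤ} (hi : 0 ≤ i) (hij : i ≤ j) :
    1 / 8 * (√|(i : ℝ)| + √|(j : ℝ)|) ≤ sqrtWeight i j := by
  unfold sqrtWeight
  rw [if_pos hi]
  unfold sqrtWeightAux
  have hi' : (0 : ℝ) ≤ i := by exact_mod_cast hi
  have hij' : (i : ℝ) ≤ j := by exact_mod_cast hij
  rw [abs_of_nonneg hi', abs_of_nonneg (hi'.trans hij')]
  have h1 : √(i : ℝ) ≤ √((j : ℝ) + 1) := Real.sqrt_le_sqrt (by linarith)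
  have h2 : √(j : ℝ) ≤ √((j : ℝ) + 1) := Real.sqrt_le_sqrt (by linarith)
  have hs : 0 < √((j : ℝ) + 1) := Real.sqrt_pos.2 (by linarith)
  have h3 : (i : ℝ) * (1 / (2 * √((j : ℝ) + 1))) ≤ 1 / 2 * √((j : ℝ) + 1) := by
    rw [mul_one_div, div_le_iff₀ (by positivity)]
    have := Real.sq_sqrt (show (0 : ℝ) ≤ j + 1 by linarith)
    nlinarith
  linarith

theorem le_sqrtWeight {i j : ℤ} (hij : i ≤ j) :
    1 / 8 * (√|(i : ℝ)| + √|(j : ℝ)|) ≤ sqrtWeight i j := by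
  by_cases hi : 0 ≤ i
  · exact le_sqrtWeight_of_nonneg hi hij
  · by_cases hj : j ≤ 0
    · have := le_sqrtWeight_of_nonneg (i := -j) (j := -i) (by omega) (by omega)
      rw [sqrtWeight_neg_neg hij] at this
      push_cast at this
      rwa [abs_neg, abs_neg, add_comm] at this
    · unfold sqrtWeight
      rw [if_neg hi, if_neg hj]
      have hi' : (i : ℝ) ≤ 0 := by exact_mod_cast (by omega : i ≤ 0)
      have hj' : (0 : ℝ) ≤ j := by exact_mod_cast (by omega : (0 : ℤ) ≤ j)
      rw [abs_of_nonpos hi', abs_of_nonneg hj']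
      have h1 : √(-(i : ℝ)) ≤ √((j : ℝ) - i + 1) := Real.sqrt_le_sqrt (by linarith)
      have h2 : √(j : ℝ) ≤ √((j : ℝ) - i + 1) := Real.sqrt_le_sqrt (by linarith)
      have hs : 0 ≤ √((j : ℝ) - i + 1) := Real.sqrt_nonneg _
      linarith

theorem sqrtWeight_nonneg {i j : ℤ} (hij : i ≤ j) : 0 ≤ sqrtWeight i j :=
  le_trans (by positivity) (le_sqrtWeight hij)

theorem sqrtWeight_zero_one_lt : sqrtWeight 0 1 < 1 := by
  unfold sqrtWeight sqrtWeightAux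
  have : √(2 : ℝ) < 2 := by
    rw [Real.sqrt_lt' (by norm_num)]
    norm_num
  norm_num
  linarith

theorem summable_exp_neg_sqrtWeight {A : ℝ} (hA : 0 < A) :
    Summable fun p : ℤ × ℤ =>
      Real.exp (-(A * (1 / 8 * (√|(p.1 : ℝ)| + √|(p.2 : ℝ)|)))) := by
  have h0 : Summable fun n : ℕ => Real.exp (-(A / 8 * √(n : ℝ))) := by
    have hs : Summable fun n : ℕ => 24 / (A / 8) ^ 4 * (1 / (n : ℝ) ^ 2) :=
      (Real.summable_one_div_nat_pow.2 one_lt_two).mul_left _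
    refine hs.of_norm_bounded_eventually_nat ?_
    filter_upwards [Filter.eventually_gt_atTop 0] with n hn
    have hn' : (0 : ℝ) < n := by exact_mod_cast hn
    rw [Real.norm_eq_abs, abs_of_pos (Real.exp_pos _), Real.exp_neg]
    have hx : 0 < A / 8 * √(n : ℝ) := by positivity
    -- The fourth power turns the root into `n ^ 2`, enough for summability; 24 is 4!.
    have h1 := Real.pow_div_factorial_le_exp (A / 8 * √(n : ℝ)) hx.le 4
    have h2 : (A / 8 * √(n : ℝ)) ^ 4 = (A / 8) ^ 4 * (n : ℝ) ^ 2 := by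
      rw [mul_pow, show √(n : ℝ) ^ 4 = (√(n : ℝ) ^ 2) ^ 2 by ring, Real.sq_sqrt hn'.le]
    rw [h2, show ((Nat.factorial 4 : ℕ) : ℝ) = 24 by norm_num [Nat.factorial]] at h1
    refine (inv_anti₀ (by positivity) h1).trans (le_of_eq ?_)
    field_simp
  have h1 : Summable fun n : ℤ => Real.exp (-(A / 8 * √|(n : ℝ)|)) := by
    refine Summable.of_nat_of_neg ?_ ?_
    · simpa using h0
    · simpa using h0
  refine (h1.mul_of_nonneg h1 (fun _ => (Real.exp_pos _).le) fun _ => (Real.exp_pos _).le).congr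
    fun p => ?_
  rw [← Real.exp_add]
  congr 1
  ring

theorem SimpleGraph.IsTwoSidedPath.exists_equiv {V : Type*} {G : SimpleGraph V}
    (h : G.IsTwoSidedPath) (v : V) :
    ∃ e : ℤ ≃ V, e 0 = v ∧ ∀ a b, G.Adj (e a) (e b) ↔ b = a + 1 ∨ a = b + 1 := by
  obtain ⟨f⟩ := h
  refine ⟨(Equiv.addRight (f v)).trans f.symm.toEquiv, ?_, fun a b => ?_⟩
  · show f.symm (0 + f v) = v
    simp
  · show G.Adj (f.symm (a + f v)) (f.symm (b + f v)) ↔ _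
    rw [f.symm.map_adj_iff]
    show b + f v = a + f v + 1 ∨ a + f v = b + f v + 1 ↔ _
    omega

end Path

/-! ### Uniform levels and concentration. -/

section Uniform

variable {Ω : Type*} [MeasurableSpace Ω] {P : Measure Ω}

theorem measure_preimage_of_isUniform {X : Ω → ℝ} (hX : pdf.IsUniform X (Set.Icc (0 : ℝ) 1) P volume)
    {A : Set ℝ} (hA : MeasurableSet A) : P (X ⁻¹' A) = volume (Set.Icc (0 : ℝ) 1 ∩ A) := by
  rw [hX.measure_preimage (by simp) (by simp) hA]
  simp

theorem ae_mem_Ico_of_isUniform {X : Ω → ℝ} (hX : pdf.IsUniform X (Set.Icc (0 : ℝ) 1) P volume) :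
    ∀ᵐ ω ∂P, X ω ∈ Set.Ico (0 : ℝ) 1 := by
  have h := measure_preimage_of_isUniform hX (measurableSet_Ico (a := (0 : ℝ)) (b := 1)).compl
  rw [← Set.sdiff_eq, Set.Icc_sdiff_Ico_same zero_le_one, Real.volume_singleton] at h
  exact h

theorem integral_of_isUniform {X : Ω → ℝ} (hX : pdf.IsUniform X (Set.Icc (0 : ℝ) 1) P volume) :
    ∫ ω, X ω ∂P = 1 / 2 := by
  rw [hX.integral_eq, integral_Icc_eq_integral_Ioc, ← intervalIntegral.integral_of_le zero_le_one,
    integral_id]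
  simp

theorem measure_ge_of_isUniform {X : Ω → ℝ} (hX : pdf.IsUniform X (Set.Icc (0 : ℝ) 1) P volume)
    {ℓ : ℝ} (h0 : 0 ≤ ℓ) : P {ω | ℓ ≤ X ω} = ENNReal.ofReal (1 - ℓ) := by
  have h := measure_preimage_of_isUniform hX (measurableSet_Ici (a := ℓ))
  have h1 : Set.Icc (0 : ℝ) 1 ∩ Set.Ici ℓ = Set.Icc ℓ 1 := by
    ext x
    simp only [Set.mem_inter_iff, Set.mem_Icc, Set.mem_Ici]
    constructor
    · exact fun h => ⟨h.2, h.1.2⟩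
    · exact fun h => ⟨⟨h0.trans h.1, h.2⟩, h.1⟩
  rw [h1, Real.volume_Icc] at h
  exact h

theorem measure_le_pos_of_isUniform {X : Ω → ℝ}
    (hX : pdf.IsUniform X (Set.Icc (0 : ℝ) 1) P volume) {ℓ : ℝ} (h0 : 0 < ℓ) :
    0 < P (X ⁻¹' Set.Iic ℓ) := by
  rw [measure_preimage_of_isUniform hX measurableSet_Iic]
  have h1 : Set.Icc (0 : ℝ) (min 1 ℓ) ⊆ Set.Icc (0 : ℝ) 1 ∩ Set.Iic ℓ := fun x hx =>
    ⟨⟨hx.1, hx.2.trans (min_le_left _ _)⟩, hx.2.trans (min_le_right _ _)⟩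
  refine lt_of_lt_of_le ?_ (measure_mono h1)
  rw [Real.volume_Icc, ENNReal.ofReal_pos, sub_zero]
  exact lt_min one_pos h0

variable [IsProbabilityMeasure P]

theorem hasSubgaussianMGF_of_isUniform {X : Ω → ℝ} (hm : Measurable X)
    (hX : pdf.IsUniform X (Set.Icc (0 : ℝ) 1) P volume) :
    HasSubgaussianMGF (fun ω => X ω - 1 / 2) (1 / 4) P := by
  have h := hasSubgaussianMGF_of_mem_Icc (a := 0) (b := 1) hm.aemeasurable
    ((ae_mem_Ico_of_isUniform hX).mono fun ω hω => ⟨hω.1, hω.2.le⟩)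
  rw [integral_of_isUniform hX] at h
  have e : ((‖(1 : ℝ) - 0‖₊ / 2) ^ 2 : NNReal) = 1 / 4 := by
    rw [sub_zero, nnnorm_one]
    norm_num
  rwa [e] at h

/-- Hoeffding's exponent is 2(δm + s)²/m with m the cardinality, and (δm + s)² ≥ 4δms removes m,
leaving a bound governed by s alone. -/
theorem measure_sum_gt_le {ι : Type*} {Y : ι → Ω → ℝ} (hmeas : ∀ u, Measurable (Y u))
    (hindep : iIndepFun Y P) (hunif : ∀ u, pdf.IsUniform (Y u) (Set.Icc (0 : ℝ) 1) P volume)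
    (T : Finset ι) {δ s : ℝ} (hδ : 0 < δ) (hs : 0 ≤ s) :
    P {ω | δ * T.card + s < ∑ u ∈ T, (Y u ω - 1 / 2)} ≤ ENNReal.ofReal (Real.exp (-(8 * δ * s))) := by
  rcases T.eq_empty_or_nonempty with rfl | hT
  · have : {ω : Ω | δ * ((∅ : Finset ι).card : ℝ) + s < ∑ u ∈ (∅ : Finset ι), (Y u ω - 1 / 2)}
        = ∅ := by
      ext ω
      simpa using hs
    rw [this, measure_empty]
    exact zero_le
  · have hm : (0 : ℝ) < T.card := by exact_mod_cast hT.card_pos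
    have h1 : iIndepFun (fun u ω => Y u ω - 1 / 2) P :=
      hindep.comp (fun _ x => x - 1 / 2) fun _ => measurable_id.sub_const _
    have h2 := HasSubgaussianMGF.measure_sum_ge_le_of_iIndepFun h1 (c := fun _ => 1 / 4) (s := T)
      (fun u _ => hasSubgaussianMGF_of_isUniform (hmeas u) (hunif u))
      (ε := δ * T.card + s) (by positivity)
    have h3 : {ω | δ * T.card + s < ∑ u ∈ T, (Y u ω - 1 / 2)}
        ⊆ {ω | δ * T.card + s ≤ ∑ u ∈ T, (Y u ω - 1 / 2)} := by
      intro ω hω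
      exact (show δ * T.card + s < ∑ u ∈ T, (Y u ω - 1 / 2) from hω).le
    refine (measure_mono h3).trans
      ((ENNReal.le_ofReal_iff_toReal_le (measure_ne_top _ _) (Real.exp_pos _).le).2
        (h2.trans (Real.exp_le_exp.2 ?_)))
    have e : (2 * ((∑ _i ∈ T, (1 / 4 : NNReal) : NNReal) : ℝ)) = T.card / 2 := by
      rw [Finset.sum_const, nsmul_eq_mul]
      push_cast
      ring
    rw [e, div_le_iff₀ (by positivity)]
    nlinarith [sq_nonneg (δ * T.card - s)]

end Uniform

/-! ### Graphs other than the two-sided path. -/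

section Branching

variable {Ω : Type*} [MeasurableSpace Ω] {P : Measure Ω} [IsProbabilityMeasure P]
  {V : Type*} {η : V → Ω → ℝ}

theorem integral_prod_branches (hmeas : ∀ u, Measurable (η u)) (hindep : iIndepFun η P)
    (hunif : ∀ u, pdf.IsUniform (η u) (Set.Icc (0 : ℝ) 1) P volume) {n : ℕ} {y : ℕ → V}
    (hy : ∀ k < n, ∀ l < n, y k = y l → k = l) (w : ℕ → ℝ) {ℓ : ℝ} (h0 : 0 ≤ ℓ) (h1 : ℓ ≤ 1) :
    ∫ ω, ∏ k ∈ Finset.range n, (1 - (if ℓ ≤ η (y k) ω then (1 : ℝ) else 0) * w k) ∂P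
      = ∏ k ∈ Finset.range n, (1 - (1 - ℓ) * w k) := by
  have hinj : Function.Injective (fun k : Fin n => y k) := fun a b hab =>
    Fin.ext (hy a a.2 b b.2 hab)
  have hf : ∀ k : Fin n, Measurable (fun x : ℝ => 1 - (if ℓ ≤ x then (1 : ℝ) else 0) * w k) :=
    fun k => ((Measurable.ite measurableSet_Ici measurable_const measurable_const).mul_const
      _).const_sub _
  have h := (hindep.precomp hinj).integral_fun_prod_comp
    (f := fun (k : Fin n) (x : ℝ) => 1 - (if ℓ ≤ x then (1 : ℝ) else 0) * w k)
    (fun k => (hmeas _).aemeasurable) (fun k => (hf k).aestronglyMeasurable)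
  simp only [Finset.prod_range]
  rw [h]
  refine Finset.prod_congr rfl fun k _ => ?_
  have hset : MeasurableSet {ω | ℓ ≤ η (y k) ω} := hmeas _ measurableSet_Ici
  have hind : (fun ω => if ℓ ≤ η (y k) ω then (1 : ℝ) else 0)
      = {ω | ℓ ≤ η (y k) ω}.indicator fun _ => (1 : ℝ) := by
    ext ω
    simp [Set.indicator_apply]
  have hint : Integrable (fun ω => if ℓ ≤ η (y k) ω then (1 : ℝ) else 0) P := by
    rw [hind]
    exact (integrable_const _).indicator hset
  rw [integral_sub (integrable_const _) (hint.mul_const _), integral_mul_const, hind,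
    integral_indicator_const _ hset, measureReal_def, measure_ge_of_isUniform (hunif _) h0,
    ENNReal.toReal_ofReal (by linarith)]
  simp

/-- By 1 - t ≤ exp(-t), linear growth of the branch positions yields a harmonic sum in the exponent.
-/
theorem prod_branches_le {n C : ℕ} {i : ℕ → ℕ} (hi : ∀ k < n, i k + 1 ≤ C * (k + 1)) {p : ℝ}
    (h0 : 0 ≤ p) (h1 : p ≤ 1) :
    ∏ k ∈ Finset.range n, (1 - p * (1 / (2 * ((i k : ℝ) + 1))))
      ≤ Real.exp (-(p / (2 * C) * ∑ k ∈ Finset.range n, 1 / ((k : ℝ) + 1))) := by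
  rw [Finset.mul_sum, ← Finset.sum_neg_distrib, Real.exp_sum]
  refine Finset.prod_le_prod (fun k _ => ?_) fun k hk => ?_
  · have : 1 / (2 * ((i k : ℝ) + 1)) ≤ 1 := by
      rw [div_le_one (by positivity)]
      have : (0 : ℝ) ≤ i k := by positivity
      linarith
    nlinarith [show (0 : ℝ) ≤ 1 / (2 * ((i k : ℝ) + 1)) by positivity]
  · have h2 : ((i k : ℝ) + 1) ≤ C * (k + 1) := by exact_mod_cast hi k (Finset.mem_range.1 hk)
    have h3 : 1 / (2 * ((C : ℝ) * (k + 1))) ≤ 1 / (2 * ((i k : ℝ) + 1)) :=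
      one_div_le_one_div_of_le (by positivity) (by linarith)
    have h4 : p / (2 * C) * (1 / ((k : ℝ) + 1)) = p * (1 / (2 * ((C : ℝ) * (k + 1)))) := by
      rw [div_mul_div_comm, mul_one, mul_one_div, mul_assoc]
    have h5 := Real.add_one_le_exp (-(p / (2 * C) * (1 / ((k : ℝ) + 1))))
    rw [h4] at h5 ⊢
    nlinarith

theorem ae_waterKappa_eq_one [Infinite V] {G : SimpleGraph V} (hconn : G.Connected)
    (hfin : ∀ u, (G.neighborSet u).Finite) (hqt : G.IsQuasiTransitive)
    (hG : ¬ G.IsTwoSidedPath) (hmeas : ∀ u, Measurable (η u)) (hindep : iIndepFun η P)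
    (hunif : ∀ u, pdf.IsUniform (η u) (Set.Icc (0 : ℝ) 1) P volume) (v : V) :
    ∀ᵐ ω ∂P, waterKappa G (fun u => η u ω) v = 1 := by
  have : Countable V := countable_of_connected_of_finite_neighborSet hconn hfin
  have hae : ∀ᵐ ω ∂P, ∀ u, η u ω ∈ Set.Icc (0 : ℝ) 1 :=
    ae_all_iff.2 fun u => (ae_mem_Ico_of_isUniform (hunif u)).mono fun ω h => ⟨h.1, h.2.le⟩
  have hκm : Measurable fun ω => waterKappa G (fun u => η u ω) v :=
    (measurable_waterKappa v).comp (measurable_pi_lambda _ hmeas)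
  have hbd : ∀ᵐ ω ∂P, 1 - waterKappa G (fun u => η u ω) v ∈ Set.Icc (0 : ℝ) 1 := by
    filter_upwards [hae] with ω hω
    have h1 := waterKappa_le_one (G := G) hω v
    have h2 := (hω v).1.trans (le_waterKappa hω (self_mem_waterClosure (G := G) _) v)
    exact ⟨by linarith, by linarith⟩
  have hint : Integrable (fun ω => 1 - waterKappa G (fun u => η u ω) v) P :=
    Integrable.of_mem_Icc 0 1 (hκm.const_sub 1).aemeasurable hbd
  have hw : ∃ w, (G.neighborSet w).encard ≠ 2 := by
    by_contra! h
    exact hG (isTwoSidedPath_of_encard_neighborSet hconn h)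
  obtain ⟨C, hC⟩ := exists_path_with_branches hconn hfin hqt hw v
  have hCpos : 0 < C := by
    obtain ⟨_, _, i, _, _, _, _, h, _⟩ := hC 1
    have := (h 0 one_pos).2
    exact Nat.pos_of_ne_zero fun h0 => by simp [h0] at this
  -- The path depends on `n`, but bounding expectations avoids comparing paths for different `n`.
  have hle : ∀ ℓ : ℝ, 0 ≤ ℓ → ℓ < 1 → ∫ ω, (1 - waterKappa G (fun u => η u ω) v) ∂P ≤ 1 - ℓ := by
    intro ℓ h0 h1
    have hn : ∀ n : ℕ, ∫ ω, (1 - waterKappa G (fun u => η u ω) v) ∂P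
        ≤ (1 - ℓ) + Real.exp (-((1 - ℓ) / (2 * C) *
          ∑ k ∈ Finset.range n, 1 / ((k : ℝ) + 1))) := by
      intro n
      obtain ⟨N, x, i, y, hx0, hadj, hinj, hi, hmono, hy, hyinj, hyx⟩ := hC n
      refine le_trans ?_ (add_le_add le_rfl (prod_branches_le (fun k hk => (hi k hk).2)
        (by linarith : 0 ≤ 1 - ℓ) (by linarith)))
      rw [← integral_prod_branches hmeas hindep hunif hyinj _ h0 h1.le]
      set F : Ω → ℝ := fun ω => ∏ k ∈ Finset.range n,
        (1 - (if ℓ ≤ η (y k) ω then (1 : ℝ) else 0) * (1 / (2 * ((i k : ℝ) + 1)))) with hF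
      have hFm : Measurable F := by
        refine Finset.measurable_fun_prod _ fun k _ => ?_
        exact ((Measurable.ite (hmeas _ measurableSet_Ici) measurable_const
          measurable_const).mul_const _).const_sub _
      have hFb : ∀ ω, F ω ∈ Set.Icc (0 : ℝ) 1 := by
        intro ω
        have hw : ∀ k ∈ Finset.range n, (1 - (if ℓ ≤ η (y k) ω then (1 : ℝ) else 0)
            * (1 / (2 * ((i k : ℝ) + 1)))) ∈ Set.Icc (0 : ℝ) 1 := by
          intro k _
          have h3 : 1 / (2 * ((i k : ℝ) + 1)) ≤ 1 := by
            rw [div_le_one (by positivity)]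
            have : (0 : ℝ) ≤ i k := by positivity
            linarith
          have h4 : (0 : ℝ) ≤ 1 / (2 * ((i k : ℝ) + 1)) := by positivity
          split_ifs
          · exact ⟨by linarith, by linarith⟩
          · exact ⟨by linarith, by linarith⟩
        exact ⟨Finset.prod_nonneg fun k hk => (hw k hk).1,
          Finset.prod_le_one (fun k hk => (hw k hk).1) fun k hk => (hw k hk).2⟩
      have hFint : Integrable F P :=
        Integrable.of_mem_Icc 0 1 hFm.aemeasurable (ae_of_all _ hFb)
      have hc : (1 - ℓ) + ∫ ω, F ω ∂P = ∫ ω, ((1 - ℓ) + F ω) ∂P := by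
        rw [integral_add (integrable_const _) hFint]
        simp
      rw [hc]
      refine integral_mono_ae hint ((integrable_const _).add hFint) ?_
      filter_upwards [hae] with ω hω
      have h5 := waterKappa_ge_of_branches hω hadj hinj (fun k hk => (hi k hk).1) hmono hy hyinj
        hyx ℓ
      rw [hx0] at h5
      have h6 : ℓ * F ω ≤ F ω := by nlinarith [(hFb ω).1]
      have h7 : ℓ - ℓ * F ω ≤ waterKappa G (fun u => η u ω) v := h5
      show 1 - waterKappa G (fun u => η u ω) v ≤ 1 - ℓ + F ω
      linarith
    have hlim : Filter.Tendsto (fun n : ℕ => (1 - ℓ) + Real.exp (-((1 - ℓ) / (2 * C) *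
          ∑ k ∈ Finset.range n, 1 / ((k : ℝ) + 1)))) Filter.atTop (nhds ((1 - ℓ) + 0)) := by
      refine Filter.Tendsto.const_add _ (Real.tendsto_exp_neg_atTop_nhds_zero.comp ?_)
      refine Filter.Tendsto.const_mul_atTop ?_ Real.tendsto_sum_range_one_div_nat_succ_atTop
      have : (0 : ℝ) < C := by exact_mod_cast hCpos
      have : 0 < 1 - ℓ := by linarith
      positivity
    have := ge_of_tendsto' hlim hn
    linarith
  have hzero : ∫ ω, (1 - waterKappa G (fun u => η u ω) v) ∂P = 0 := by
    refine le_antisymm (le_of_forall_pos_lt_add fun ε hε => ?_)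
      (integral_nonneg_of_ae (hbd.mono fun ω h => h.1))
    have := hle (max 0 (1 - ε / 2)) (le_max_left _ _) (max_lt one_pos (by linarith))
    have h2 := le_max_right 0 (1 - ε / 2)
    linarith
  have h := (integral_eq_zero_iff_of_nonneg_ae (hbd.mono fun ω h => h.1) hint).1 hzero
  filter_upwards [h] with ω hω
  have : 1 - waterKappa G (fun u => η u ω) v = 0 := hω
  linarith

end Branching

/-! ### Almost sure bounds and support on the two-sided path. -/

section PathProbability

variable {Ω : Type*} [MeasurableSpace Ω] {P : Measure Ω} [IsProbabilityMeasure P]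

/-- The centred partial sums of independent uniform levels are almost surely positive at some
time. -/
theorem ae_exists_sum_pos {Y : ℕ → Ω → ℝ} (hmeas : ∀ k, Measurable (Y k)) (hindep : iIndepFun Y P)
    (hunif : ∀ k, pdf.IsUniform (Y k) (Set.Icc (0 : ℝ) 1) P volume) :
    ∀ᵐ ω ∂P, ∃ n : ℕ, 0 < ∑ k ∈ Finset.range (n + 1), (Y k ω - 1 / 2) := by
  set X : ℕ → Ω → ℝ := fun k ω => Y k ω - 1 / 2 with hX
  have hXm : ∀ k, StronglyMeasurable (X k) := fun k => ((hmeas k).sub_const _).stronglyMeasurable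
  have hXindep : iIndepFun X P := hindep.comp (fun _ x => x - 1 / 2) fun _ => measurable_id.sub_const _
  have hI : ∀ k, ∀ᵐ ω ∂P, X k ω ∈ Set.Icc (-(1 / 2) : ℝ) (1 / 2) := fun k => by
    filter_upwards [ae_mem_Ico_of_isUniform (hunif k)] with ω hω
    simp only [hX, Set.mem_Icc]
    exact ⟨by linarith [hω.1], by linarith [hω.2]⟩
  have hXint : ∀ k, Integrable (X k) P := fun k =>
    Integrable.of_mem_Icc _ _ (hXm k).measurable.aemeasurable (hI k)
  have hX0 : ∀ k, ∫ ω, X k ω ∂P = 0 := fun k => by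
    have hYint : Integrable (Y k) P := by
      refine Integrable.of_mem_Icc 0 1 (hmeas k).aemeasurable ?_
      exact (ae_mem_Ico_of_isUniform (hunif k)).mono fun ω h => ⟨h.1, h.2.le⟩
    simp only [hX]
    rw [integral_sub hYint (integrable_const _), integral_of_isUniform (hunif k)]
    simp
  set ℱ := Filtration.natural X hXm
  set S : ℕ → Ω → ℝ := fun n ω => ∑ k ∈ Finset.range (n + 1), X k ω with hS
  have hSdiff : ∀ n, S (n + 1) - S n = X (n + 1) := fun n => by
    ext ω
    simp [hS, Finset.sum_range_succ _ (n + 1)]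
  -- A martingale with bounded increments converges almost surely where it is bounded above. Its
  -- increments would then tend to 0, although infinitely many are at least 1/4 by Borel–Cantelli.
  have hmart : Martingale S ℱ P := by
    refine martingale_of_condExp_sub_eq_zero_nat (fun n => ?_) (fun n => ?_) fun n => ?_
    · refine Finset.stronglyMeasurable_fun_sum _ fun k hk => ?_
      exact (Filtration.stronglyAdapted_natural hXm k).mono
        (ℱ.mono (Nat.lt_succ_iff.1 (Finset.mem_range.1 hk)))
    · exact integrable_finsetSum _ fun k _ => hXint k
    · rw [hSdiff]
      refine (iIndepFun.condExp_natural_ae_eq_of_lt hXm hXindep (Nat.lt_succ_self n)).trans ?_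
      rw [hX0]
      rfl
  have hbdd : ∀ᵐ ω ∂P, ∀ n, |S (n + 1) ω - S n ω| ≤ ((1 : NNReal) : ℝ) := by
    filter_upwards [ae_all_iff.2 hI] with ω hω n
    have h1 : S (n + 1) ω - S n ω = X (n + 1) ω := congrFun (hSdiff n) ω
    rw [h1, abs_le]
    push_cast
    exact ⟨by linarith [(hω (n + 1)).1], by linarith [(hω (n + 1)).2]⟩
  have hfreq : ∀ᵐ ω ∂P, ∃ᶠ n in Filter.atTop, 3 / 4 ≤ Y n ω := by
    have hm : ∀ n, MeasurableSet {ω | 3 / 4 ≤ Y n ω} := fun n => hmeas n measurableSet_Ici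
    have hlim := measure_limsup_eq_one (μ := P) (s := fun n => {ω | 3 / 4 ≤ Y n ω}) hm
      ((iIndepSet_iff_meas_biInter hm).2 fun s =>
        hindep.measure_inter_preimage_eq_mul s (sets := fun _ => Set.Ici (3 / 4))
          fun _ _ => measurableSet_Ici) (by
        simp only [measure_ge_of_isUniform (hunif _) (show (0 : ℝ) ≤ 3 / 4 by norm_num)]
        exact ENNReal.tsum_const_eq_top_of_ne_zero (by norm_num))
    have h2 := (prob_compl_eq_zero_iff (μ := P) (MeasurableSet.measurableSet_limsup hm)).2 hlim
    have h3 : ∀ᵐ ω ∂P, ω ∈ Filter.limsup (fun n => {ω | 3 / 4 ≤ Y n ω}) Filter.atTop := h2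
    filter_upwards [h3] with ω hω
    exact Filter.mem_limsup_iff_frequently_mem.1 hω
  filter_upwards [hmart.submartingale.bddAbove_iff_exists_tendsto hbdd, hfreq] with ω hω hω'
  by_contra! hneg
  obtain ⟨c, hc⟩ := hω.1 ⟨0, by rintro _ ⟨n, rfl⟩; exact hneg n⟩
  have h1 : Filter.Tendsto (fun n => S (n + 1) ω - S n ω) Filter.atTop (nhds (c - c)) :=
    ((Filter.tendsto_add_atTop_iff_nat 1).2 hc).sub hc
  have h2 : ∀ n, S (n + 1) ω - S n ω = Y (n + 1) ω - 1 / 2 := fun n => congrFun (hSdiff n) ω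
  simp only [h2, sub_self] at h1
  have h3 : Filter.Tendsto (fun n => Y n ω - 1 / 2) Filter.atTop (nhds 0) :=
    (Filter.tendsto_add_atTop_iff_nat 1).1 h1
  have h4 := h3.eventually_lt_const (show (0 : ℝ) < 1 / 4 by norm_num)
  obtain ⟨n, h5, h6⟩ := (hω'.and_eventually h4).exists
  linarith

variable {V : Type*} {G : SimpleGraph V} {η : V → Ω → ℝ}

theorem ae_half_lt_waterKappa [Countable V] {e : ℕ → V} (he : Function.Injective e)
    (hadj : ∀ k, G.Adj (e k) (e (k + 1))) (hmeas : ∀ u, Measurable (η u))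
    (hindep : iIndepFun η P)
    (hunif : ∀ u, pdf.IsUniform (η u) (Set.Icc (0 : ℝ) 1) P volume) :
    ∀ᵐ ω ∂P, 1 / 2 < waterKappa G (fun u => η u ω) (e 0) := by
  classical
  have hae : ∀ᵐ ω ∂P, ∀ u, η u ω ∈ Set.Icc (0 : ℝ) 1 :=
    ae_all_iff.2 fun u => (ae_mem_Ico_of_isUniform (hunif u)).mono fun ω h => ⟨h.1, h.2.le⟩
  filter_upwards [hae, ae_exists_sum_pos (fun k => hmeas (e k)) (hindep.precomp he)
    fun k => hunif (e k)] with ω hω ⟨n, hn⟩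
  obtain ⟨ξ, hξ, -, hs⟩ := exists_average (G := G) (η := fun u => η u ω) hω
    (self_mem_waterClosure _) (edgeRigid_image_range (x := e) (n := n) fun i _ => hadj i)
  refine lt_of_lt_of_le ?_ (le_waterKappa hω hξ (e 0))
  have h := hs (e 0) (Finset.mem_image_of_mem _ (Finset.mem_range.2 (Nat.succ_pos n)))
  rw [Finset.card_image_of_injective _ he, Finset.card_range,
    Finset.sum_image he.injOn] at h
  rw [Finset.sum_sub_distrib, ← h] at hn
  simp only [Finset.sum_const, Finset.card_range, nsmul_eq_mul] at hn
  have h2 : (0 : ℝ) < ((n + 1 : ℕ) : ℝ) := by positivity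
  nlinarith

theorem tsum_exp_neg_sqrtWeight_ne_top {A : ℝ} (hA : 0 < A) :
    ∑' p : ℤ × ℤ, ENNReal.ofReal
      (Real.exp (-(A * (1 / 8 * (√|(p.1 : ℝ)| + √|(p.2 : ℝ)|))))) ≠ ⊤ :=
  (summable_exp_neg_sqrtWeight hA).tsum_ofReal_ne_top

/-- The profile contains too much water outside of `S` on the interval `[p.1, p.2)`. -/
def overfullEvent (Y : ℤ → Ω → ℝ) (S : Finset ℤ) (δ γ : ℝ) (p : ℤ × ℤ) : Set Ω :=
  {ω | p.1 ≤ p.2 ∧ δ * (Finset.Ico p.1 p.2 \ S).card + γ * sqrtWeight p.1 p.2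
    < ∑ u ∈ Finset.Ico p.1 p.2 \ S, (Y u ω - 1 / 2)}

theorem measure_overfullEvent_le {Y : ℤ → Ω → ℝ} (hmeas : ∀ k, Measurable (Y k))
    (hindep : iIndepFun Y P) (hunif : ∀ k, pdf.IsUniform (Y k) (Set.Icc (0 : ℝ) 1) P volume)
    (S : Finset ℤ) {δ γ : ℝ} (hδ : 0 < δ) (hγ : 0 < γ) (p : ℤ × ℤ) :
    P (overfullEvent Y S δ γ p) ≤ ENNReal.ofReal
      (Real.exp (-(8 * δ * γ * (1 / 8 * (√|(p.1 : ℝ)| + √|(p.2 : ℝ)|))))) := by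
  unfold overfullEvent
  by_cases hp : p.1 ≤ p.2
  · simp only [hp, true_and]
    refine (measure_sum_gt_le hmeas hindep hunif _ hδ
      (mul_nonneg hγ.le (sqrtWeight_nonneg hp))).trans ?_
    refine ENNReal.ofReal_le_ofReal (Real.exp_le_exp.2 ?_)
    have := mul_le_mul_of_nonneg_left (le_sqrtWeight hp) (show 0 ≤ 8 * δ * γ by positivity)
    linarith
  · simp [hp]

theorem ae_waterKappa_lt_one [Countable V] (e : ℤ ≃ V)
    (he : ∀ a b, G.Adj (e a) (e b) ↔ b = a + 1 ∨ a = b + 1) (hmeas : ∀ u, Measurable (η u))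
    (hindep : iIndepFun η P)
    (hunif : ∀ u, pdf.IsUniform (η u) (Set.Icc (0 : ℝ) 1) P volume) :
    ∀ᵐ ω ∂P, waterKappa G (fun u => η u ω) (e 0) < 1 := by
  have hae : ∀ᵐ ω ∂P, ∀ u, η u ω ∈ Set.Ico (0 : ℝ) 1 :=
    ae_all_iff.2 fun u => ae_mem_Ico_of_isUniform (hunif u)
  have hfin := ae_finite_setOfPred_mem (μ := P)
    (s := overfullEvent (fun k => η (e k)) ∅ (1 / 4) (1 / 4))
    (ne_top_of_le_ne_top (tsum_exp_neg_sqrtWeight_ne_top (A := 8 * (1 / 4) * (1 / 4)) (by norm_num))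
      (ENNReal.tsum_le_tsum fun p => measure_overfullEvent_le (fun k => hmeas (e k))
        (hindep.precomp e.injective) (fun k => hunif (e k)) ∅ (by norm_num) (by norm_num) p))
  filter_upwards [hae, hfin] with ω hω hω'
  have hsum_lt : ∀ i j : ℤ, i < j → ∑ u ∈ Finset.Ico i j, η (e u) ω < (j : ℝ) - i := by
    intro i j hij
    have h1 : ∑ u ∈ Finset.Ico i j, η (e u) ω < ∑ u ∈ Finset.Ico i j, (1 : ℝ) :=
      Finset.sum_lt_sum_of_nonempty (Finset.nonempty_Ico.2 hij) fun u _ => (hω _).2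
    have h2 : ((j - i).toNat : ℝ) = (j : ℝ) - i := by
      have : ((j - i).toNat : ℤ) = j - i := Int.toNat_of_nonneg (by omega)
      exact_mod_cast congrArg (Int.cast (R := ℝ)) this
    simpa [h2] using h1
  -- All levels are below 1, so content is strictly less than length; for finitely many intervals a
  -- small `c` respects this.
  have hbad : ∀ᶠ c in nhdsWithin (0 : ℝ) (Set.Ioi 0),
      ∀ p ∈ {p | ω ∈ overfullEvent (fun k => η (e k)) ∅ (1 / 4) (1 / 4) p}, p.1 < p.2 →
        ∑ u ∈ Finset.Ico p.1 p.2, η (e u) ω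
          ≤ (1 - c) * ((p.2 : ℝ) - p.1) + c * sqrtWeight p.1 p.2 := by
    refine (Filter.eventually_all_finite hω').2 fun p _ => ?_
    by_cases hp : p.1 < p.2
    · have hcont : Filter.Tendsto (fun c : ℝ => (1 - c) * ((p.2 : ℝ) - p.1)
          + c * sqrtWeight p.1 p.2) (nhdsWithin 0 (Set.Ioi 0))
          (nhds ((1 - 0) * ((p.2 : ℝ) - p.1) + 0 * sqrtWeight p.1 p.2)) :=
        Filter.Tendsto.mono_left (Continuous.tendsto (by fun_prop) 0) nhdsWithin_le_nhds
      rw [sub_zero, one_mul, zero_mul, add_zero] at hcont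
      filter_upwards [hcont.eventually_const_lt (hsum_lt _ _ hp)] with c hc _
      exact hc.le
    · exact Filter.Eventually.of_forall fun c h => (hp h).elim
  have hsmall : ∀ᶠ c in nhdsWithin (0 : ℝ) (Set.Ioi 0), c < 1 / 4 :=
    (Filter.Tendsto.mono_left Filter.tendsto_id nhdsWithin_le_nhds).eventually_lt_const
      (by norm_num)
  obtain ⟨c, ⟨hcbad, hc4⟩, hc0 : 0 < c⟩ :=
    ((hbad.and hsmall).and self_mem_nhdsWithin).exists
  have h := waterKappa_le_of_separately_concave e he
    (Φ := fun i j => (1 - c) * ((j : ℝ) - i) + c * sqrtWeight i j)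
    (fun i j hij => by
      have := sqrtWeight_concave_right hij
      push_cast
      nlinarith) (fun i j hij => by
      have := sqrtWeight_concave_left hij
      push_cast
      nlinarith) (η := fun u => η u ω) (fun i j hij => ?_) (by
      have := sqrtWeight_nonneg (i := 0) (j := 1) zero_le_one
      push_cast
      nlinarith)
  · have h1 := sqrtWeight_zero_one_lt
    push_cast at h
    nlinarith
  · rcases hij.eq_or_lt with rfl | hlt
    · have := sqrtWeight_nonneg (le_refl i)
      simp only [Finset.Ico_self, Finset.sum_empty, sub_self, mul_zero, zero_add]
      positivity
    · by_cases hp : ω ∈ overfullEvent (fun k => η (e k)) ∅ (1 / 4) (1 / 4) (i, j)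
      · exact hcbad (i, j) hp hlt
      · have h1 : ∑ u ∈ Finset.Ico i j, (η (e u) ω - 1 / 2)
            ≤ 1 / 4 * (Finset.Ico i j).card + 1 / 4 * sqrtWeight i j := by
          by_contra! hcon
          refine hp ⟨hij, ?_⟩
          simpa using hcon
        have h2 := hsum_lt i j hlt
        have h3 : ((Finset.Ico i j).card : ℝ) = (j : ℝ) - i := by
          rw [Int.card_Ico]
          have : ((j - i).toNat : ℤ) = j - i := Int.toNat_of_nonneg (by omega)
          exact_mod_cast congrArg (Int.cast (R := ℝ)) this
        rw [Finset.sum_sub_distrib, Finset.sum_const, nsmul_eq_mul, h3] at h1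
        -- If the weight exceeds the length, content below length suffices; otherwise the bound with
        -- coefficient 1/4 implies the one with `c < 1/4`.
        rcases le_total ((j : ℝ) - i) (sqrtWeight i j) with h4 | h4
        · nlinarith
        · nlinarith

theorem half_mem_distSupport [Countable V] (e : ℤ ≃ V)
    (he : ∀ a b, G.Adj (e a) (e b) ↔ b = a + 1 ∨ a = b + 1) (hmeas : ∀ u, Measurable (η u))
    (hindep : iIndepFun η P)
    (hunif : ∀ u, pdf.IsUniform (η u) (Set.Icc (0 : ℝ) 1) P volume) :
    (1 / 2 : ℝ) ∈ distSupport P (fun ω => waterKappa G (fun u => η u ω) (e 0)) := by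
  classical
  intro ε hε
  set Y : ℤ → Ω → ℝ := fun k => η (e k) with hY
  have hYm : ∀ k, Measurable (Y k) := fun k => hmeas (e k)
  have hYi : iIndepFun Y P := hindep.precomp e.injective
  have hYu : ∀ k, pdf.IsUniform (Y k) (Set.Icc (0 : ℝ) 1) P volume := fun k => hunif (e k)
  have hA : 0 < 8 * (ε / 2) * (ε / 4) := by positivity
  -- Intervals in `F` lie inside `S`, where `B` fixes low levels; the other overfull events have
  -- total probability below 1.
  obtain ⟨F, hF⟩ := ((ENNReal.tendsto_tsum_compl_atTop_zero
    (tsum_exp_neg_sqrtWeight_ne_top hA)).eventually_lt_const one_pos).exists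
  set S : Finset ℤ := F.biUnion fun p => Finset.Ico p.1 p.2 with hS
  set B : Set Ω := ⋂ u ∈ S, Y u ⁻¹' Set.Iic (1 / 2 + ε / 2) with hB
  set E : ℤ × ℤ → Set Ω := overfullEvent Y S (ε / 2) (ε / 4) with hE
  have hPB : 0 < P B := by
    rw [hB, hYi.measure_inter_preimage_eq_mul S fun _ _ => measurableSet_Iic]
    exact pos_iff_ne_zero.2 (Finset.prod_ne_zero_iff.2 fun u _ =>
      (measure_le_pos_of_isUniform (hYu u) (by positivity)).ne')
  have hEF : ∀ p ∈ F, E p = ∅ := by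
    intro p hp
    have h1 : Finset.Ico p.1 p.2 \ S = ∅ :=
      Finset.sdiff_eq_empty_iff_subset.2 fun u hu => Finset.mem_biUnion.2 ⟨p, hp, hu⟩
    ext ω
    simp only [hE, overfullEvent, h1, Set.mem_ofPred_eq, Set.mem_empty_iff_false, iff_false,
      Finset.card_empty, Finset.sum_empty, not_and, not_lt]
    intro h2
    have := sqrtWeight_nonneg h2
    positivity
  -- `B` depends only on sites in `S`, and `E p` only on sites outside `S`.
  have hBE : ∀ p, P (B ∩ E p) = P B * P (E p) := by
    intro p
    by_cases hp : p.1 ≤ p.2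
    · have hind := hYi.indepFun_finset S (Finset.Ico p.1 p.2 \ S) Finset.disjoint_sdiff hYm
      have h1 : B = (fun ω (u : S) => Y u ω) ⁻¹' (⋂ u, {x | x u ≤ 1 / 2 + ε / 2}) := by
        ext ω
        simp [hB]
      have h2 : E p = (fun ω (u : (Finset.Ico p.1 p.2 \ S : Finset ℤ)) => Y u ω) ⁻¹'
          {x | ε / 2 * (Finset.Ico p.1 p.2 \ S).card + ε / 4 * sqrtWeight p.1 p.2
            < ∑ u, (x u - 1 / 2)} := by
        ext ω
        have h3 := Finset.sum_coe_sort (Finset.Ico p.1 p.2 \ S) fun u => Y u ω - 1 / 2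
        simp only [hE, overfullEvent, hp, true_and, Set.mem_ofPred_eq, Set.mem_preimage, h3]
      rw [h1, h2]
      refine hind.measure_inter_preimage_eq_mul _ _ ?_ ?_
      · exact MeasurableSet.iInter fun u => measurableSet_le (measurable_pi_apply u) measurable_const
      · exact measurableSet_lt measurable_const (by fun_prop)
    · have : E p = ∅ := by
        ext ω
        simp [hE, overfullEvent, hp]
      rw [this]
      simp
  have hBU : P (B ∩ ⋃ p, E p) < P B := by
    have h1 : B ∩ ⋃ p, E p ⊆ ⋃ p : {p // p ∉ F}, B ∩ E p := by
      rintro ω ⟨hωB, hωE⟩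
      obtain ⟨p, hp⟩ := Set.mem_iUnion.1 hωE
      have hpF : p ∉ F := fun hpF => by
        rw [hEF p hpF] at hp
        exact hp
      exact Set.mem_iUnion.2 ⟨⟨p, hpF⟩, hωB, hp⟩
    calc P (B ∩ ⋃ p, E p) ≤ ∑' p : {p // p ∉ F}, P (B ∩ E p) :=
          (measure_mono h1).trans (measure_iUnion_le _)
      _ = P B * ∑' p : {p // p ∉ F}, P (E p) := by
          rw [← ENNReal.tsum_mul_left]
          exact tsum_congr fun p => hBE p
      _ ≤ P B * ∑' p : {p // p ∉ F}, ENNReal.ofReal (Real.exp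
            (-(8 * (ε / 2) * (ε / 4) * (1 / 8 * (√|(p.1.1 : ℝ)| + √|(p.1.2 : ℝ)|))))) := by
          gcongr with p
          exact measure_overfullEvent_le hYm hYi hYu S (by positivity) (by positivity) _
      _ < P B * 1 := (ENNReal.mul_lt_mul_iff_right hPB.ne' (measure_ne_top _ _)).2 hF
      _ = P B := mul_one _
  have hdiff : 0 < P (B \ ⋃ p, E p) := by
    by_contra! h0
    have h1 : P B ≤ P (B ∩ ⋃ p, E p) + P (B \ ⋃ p, E p) := measure_le_inter_add_sdiff _ _ _
    rw [le_zero_iff.1 h0, add_zero] at h1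
    exact hBU.not_ge h1
  refine lt_of_lt_of_le hdiff (measure_mono_ae ?_)
  have hhalf := ae_half_lt_waterKappa (G := G) (P := P) (η := η) (e := fun k : ℕ => e k)
    (fun a b hab => by exact_mod_cast e.injective hab)
    (fun k => (he _ _).2 (Or.inl (by push_cast; rfl))) hmeas hindep hunif
  filter_upwards [hhalf] with ω hω hωB
  obtain ⟨hω1, hω2⟩ := hωB
  have hlow : 1 / 2 < waterKappa G (fun u => η u ω) (e 0) := by simpa using hω
  have h := waterKappa_le_of_separately_concave e he
    (Φ := fun i j => (1 / 2 + ε / 2) * ((j : ℝ) - i) + ε / 4 * sqrtWeight i j)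
    (fun i j hij => by
      have := sqrtWeight_concave_right hij
      push_cast
      nlinarith) (fun i j hij => by
      have := sqrtWeight_concave_left hij
      push_cast
      nlinarith) (η := fun u => η u ω) (fun i j hij => ?_) (by
      have := sqrtWeight_nonneg (i := 0) (j := 1) zero_le_one
      push_cast
      nlinarith)
  · have h1 := sqrtWeight_zero_one_lt
    show |_ - _| < ε
    rw [abs_lt]
    push_cast at h
    constructor
    · linarith
    · nlinarith
  · have h1 : ∑ u ∈ Finset.Ico i j \ S, (Y u ω - 1 / 2)
        ≤ ε / 2 * (Finset.Ico i j \ S).card + ε / 4 * sqrtWeight i j := by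
      by_contra! hcon
      exact hω2 (Set.mem_iUnion.2 ⟨(i, j), hij, hcon⟩)
    have h2 : ∑ u ∈ Finset.Ico i j ∩ S, (Y u ω - 1 / 2) ≤ (Finset.Ico i j ∩ S).card • (ε / 2) := by
      refine Finset.sum_le_card_nsmul _ _ _ fun u hu => ?_
      have : Y u ω ≤ 1 / 2 + ε / 2 := Set.mem_iInter₂.1 hω1 u (Finset.mem_inter.1 hu).2
      linarith
    have h3 := Finset.sum_inter_add_sum_sdiff (Finset.Ico i j) S fun u => Y u ω - 1 / 2
    have h4 : (((Finset.Ico i j ∩ S).card : ℝ) + (Finset.Ico i j \ S).card) = (j : ℝ) - i := by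
      have h5 := Finset.card_inter_add_card_sdiff (Finset.Ico i j) S
      rw [Int.card_Ico] at h5
      have h6 : ((j - i).toNat : ℤ) = j - i := Int.toNat_of_nonneg (by omega)
      rw [← h5] at h6
      exact_mod_cast congrArg (Int.cast (R := ℝ)) h6
    have h7 : ∑ u ∈ Finset.Ico i j, (Y u ω - 1 / 2)
        = ∑ u ∈ Finset.Ico i j, Y u ω - ((j : ℝ) - i) * (1 / 2) := by
      rw [Finset.sum_sub_distrib, Finset.sum_const, nsmul_eq_mul, ← h4,
        ← Finset.card_inter_add_card_sdiff (Finset.Ico i j) S]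
      push_cast
      rfl
    rw [nsmul_eq_mul] at h2
    show ∑ u ∈ Finset.Ico i j, Y u ω ≤ _
    rw [h7] at h3
    rw [← h4] at h3 ⊢
    nlinarith

end PathProbability

/-! ### The value 1 in the support, and the conclusion. -/

theorem one_mem_distSupport {Ω : Type*} [MeasurableSpace Ω] {P : Measure Ω} {V : Type*}
    [Countable V] {G : SimpleGraph V} {η : V → Ω → ℝ}
    (hunif : ∀ u, pdf.IsUniform (η u) (Set.Icc (0 : ℝ) 1)
    P volume) (v : V) :
    (1 : ℝ) ∈ distSupport P (fun ω => waterKappa G (fun u => η u ω) v) := by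
  intro ε hε
  have hae : ∀ᵐ ω ∂P, ∀ u, η u ω ∈ Set.Icc (0 : ℝ) 1 :=
    ae_all_iff.2 fun u => (ae_mem_Ico_of_isUniform (hunif u)).mono fun ω h => ⟨h.1, h.2.le⟩
  have hpos : 0 < P {ω | max 0 (1 - ε / 2) ≤ η v ω} := by
    rw [measure_ge_of_isUniform (hunif v) (le_max_left _ _), ENNReal.ofReal_pos, sub_pos]
    exact max_lt one_pos (by linarith)
  refine lt_of_lt_of_le hpos (measure_mono_ae ?_)
  filter_upwards [hae] with ω hω hv
  have h1 : η v ω ≤ waterKappa G (fun u => η u ω) v := le_waterKappa hω (self_mem_waterClosure _) v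
  have h2 := waterKappa_le_one (G := G) hω v
  have h3 : 1 - ε / 2 ≤ η v ω := (le_max_right _ _).trans hv
  show |_ - _| < ε
  rw [abs_lt]
  exact ⟨by linarith, by linarith⟩

theorem theorem3p2 {V : Type*} [Infinite V] (G : SimpleGraph V)
    (hconn : G.Connected)
    (hdeg : ∃ D : ℕ, ∀ u : V, (G.neighborSet u).encard ≤ D)
    (hqt : G.IsQuasiTransitive)
    {Ω : Type*} [MeasurableSpace Ω] (P : Measure Ω) [IsProbabilityMeasure P]
    (η : V → Ω → ℝ)
    (hmeas : ∀ u : V, Measurable (η u))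
    (hindep : iIndepFun η P)
    (hunif : ∀ u : V, pdf.IsUniform (η u) (Set.Icc (0 : ℝ) 1) P volume)
    (v : V) :
    Measurable (fun ω => waterKappa G (fun u => η u ω) v) ∧
    (G.IsTwoSidedPath →
      (∀ᵐ ω ∂P, 1 / 2 < waterKappa G (fun u => η u ω) v ∧
        waterKappa G (fun u => η u ω) v < 1) ∧
      ({1 / 2, 1} : Set ℝ) ⊆ distSupport P (fun ω => waterKappa G (fun u => η u ω) v)) ∧
    (¬ G.IsTwoSidedPath → ∀ᵐ ω ∂P, waterKappa G (fun u => η u ω) v = 1) := by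
  obtain ⟨D, hD⟩ := hdeg
  have hfin : ∀ u, (G.neighborSet u).Finite := fun u => Set.finite_of_encard_le_coe (hD u)
  have : Countable V := countable_of_connected_of_finite_neighborSet hconn hfin
  refine ⟨(measurable_waterKappa v).comp (measurable_pi_lambda _ hmeas), fun hG => ?_,
    fun hG => ae_waterKappa_eq_one hconn hfin hqt hG hmeas hindep hunif v⟩
  obtain ⟨e, rfl, he⟩ := hG.exists_equiv v
  have hhalf := ae_half_lt_waterKappa (G := G) (P := P) (η := η) (e := fun k : ℕ => e k)
    (fun a b hab => by exact_mod_cast e.injective hab)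
    (fun k => (he _ _).2 (Or.inl (by push_cast; rfl))) hmeas hindep hunif
  constructor
  · filter_upwards [hhalf, ae_waterKappa_lt_one e he hmeas hindep hunif] with ω h1 h2
    exact ⟨by simpa using h1, h2⟩
  · rintro r (rfl | rfl)
    · exact half_mem_distSupport e he hmeas hindep hunif
    · exact one_mem_distSupport hunif _
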